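/- Let $\mathcal{E}$ be the Bargmann–Fock space of all $u\in L^2(\mathbb{C})$ of the form $u(z)=e^{-|z|^2/2}f(z)$ with $f$ entire, equipped with the $L^2$ norm, let $\Pi$ be the orthogonal projection of $L^2(\mathbb{C})$ onto $\mathcal{E}$, let $L$ be Lebesgue measure on $\mathbb{C}$, let $\langle z\rangle=(1+|z|^2)^{1/2}$, and let $\sigma\in\{1,-1\}$. Consider the system $$ i\partial_t u=\Pi(|v|^2u),\qquad i\partial_t v=\sigma\,\Pi(|u|^2v),\qquad u(0)=u_0,\quad v(0)=v_0,\qquad t\in\mathbb{R}. $$ Theorem 1.1. For every $(u_0,v_0)\in\mathcal{E}\times\mathcal{E}$ there exists a unique solution $(u,v)\in C^\infty(\mathbb{R},\mathcal{E}\times\mathcal{E})$ of this system, and it depends smoothly on $(u_0,v_0)$: the map $(t,u_0,v_0)\mapsto(u(t),v(t))$ is $C^\infty$ from $\mathbb{R}\times\mathcal{E}\times\mathcal{E}$ to $\mathcal{E}\times\mathcal{E}$ (as a map between real Banach spaces). Moreover, for every $t\in\mathbb{R}$, $$\int_{\mathbb{C}}|u(t,z)|^2dL(z)=\int_{\mathbb{C}}|u_0|^2dL,\qquad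 \int_{\mathbb{C}}|v(t,z)|^2dL(z)=\int_{\mathbb{C}}|v_0|^2dL,$$ $$\int_{\mathbb{C}}|u(t,z)|^2|v(t,z)|^2dL(z)=\int_{\mathbb{C}}|u_0|^2|v_0|^2dL,$$ where these integrals are finite. If $zu_0,zv_0\in L^2(\mathbb{C})$, then $zu(t),zv(t)\in L^2(\mathbb{C})$ for every $t\in\mathbb{R}$, and the momenta $$P_\sigma(u,v)=\int_{\mathbb{C}}(|z|^2-1)\left(|u|^2+\sigma|v|^2\right)dL,\qquad Q_\sigma(u,v)=\int_{\mathbb{C}}z\left(|u|^2+\sigma|v|^2\right)dL$$ are conserved: $P_\sigma(u(t),v(t))=P_\sigma(u_0,v_0)$ and $Q_\sigma(u(t),v(t))=Q_\sigma(u_0,v_0)$ for every $t\in\mathbb{R}$. More generally, if $\langle z\rangle^su_0,\langle z\rangle^sv_0\in L^2(\mathbb{C})$ for some $s>0$, then $\langle z\rangle^su(t),\langle z\rangle^sv(t)\in L^2(\mathbb{C})$ for every $t\in\mathbb{R}$. -/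

import Mathlib

open MeasureTheory Filter Topology
open scoped ContDiff ComplexConjugate

noncomputable section

namespace LLL

/-- The space `L²(ℂ)` of (classes of) complex functions, with respect to Lebesgue measure. -/
abbrev L2C : Type := Lp ℂ 2 (volume : Measure ℂ)

/-- The function `z ↦ e^{-|z|²/2} f(z)`. -/
def gaussMul (f : ℂ → ℂ) (z : ℂ) : ℂ := (Real.exp (-‖z‖ ^ 2 / 2) : ℂ) * f z

/-- The Bargmann-Fock space: the elements of `L²(ℂ)` of the form `e^{-|z|²/2} f(z)` with `f`
entire. It carries the `L²` norm and inner product. -/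
def BargmannFock : Submodule ℂ L2C where
  carrier := {u | ∃ f : ℂ → ℂ, Differentiable ℂ f ∧ u =ᵐ[volume] gaussMul f}
  zero_mem' := ⟨fun _ => 0, differentiable_const _, by
    filter_upwards [Lp.coeFn_zero ℂ 2 (volume : Measure ℂ)] with z hz
    rw [hz, Pi.zero_apply, gaussMul, mul_zero]⟩
  add_mem' := by
    rintro u v ⟨f, hf, huf⟩ ⟨g, hg, hvg⟩
    refine ⟨fun z => f z + g z, hf.add hg, ?_⟩
    filter_upwards [Lp.coeFn_add u v, huf, hvg] with z hz h1 h2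
    rw [hz, Pi.add_apply, h1, h2, gaussMul, gaussMul, gaussMul, mul_add]
  smul_mem' := by
    rintro c u ⟨f, hf, huf⟩
    refine ⟨fun z => c * f z, hf.const_mul c, ?_⟩
    filter_upwards [Lp.coeFn_smul c u, huf] with z hz h1
    rw [hz, Pi.smul_apply, h1, gaussMul, gaussMul, smul_eq_mul]
    ring

theorem mean_value_gauss {h : ℂ → ℂ} (hh : Differentiable ℂ h) :
    ‖h 0‖ₑ * ∫⁻ z : ℂ, ENNReal.ofReal (Real.exp (-‖z‖ ^ 2)) ≤
      ∫⁻ z : ℂ, ‖h z‖ₑ * ENNReal.ofReal (Real.exp (-‖z‖ ^ 2)) := by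
  have hcirc : ∀ r : ℝ, ‖h 0‖ₑ * ENNReal.ofReal (2 * Real.pi) ≤
      ∫⁻ θ in Set.Ioo (-Real.pi) Real.pi, ‖h (Complex.polarCoord.symm (r, θ))‖ₑ := by
    intro r
    have h1 : Real.circleAverage h 0 r = h 0 :=
      DiffContOnCl.circleAverage (hh.diffContOnCl)
    have h2 := Real.circleAverage_eq_integral_add (f := h) (c := 0) (R := r) (-Real.pi)
    rw [h1] at h2
    have h3 : (2 * Real.pi) • h 0 = ∫ θ in (-Real.pi)..Real.pi, h (circleMap 0 r θ) := by
      rw [h2, smul_smul, mul_inv_cancel₀ (by positivity), one_smul]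
      rw [intervalIntegral.integral_comp_add_right (fun θ => h (circleMap 0 r θ))]
      congr 1 <;> ring
    have h4 : ‖(2 * Real.pi) • h 0‖ₑ = ‖h 0‖ₑ * ENNReal.ofReal (2 * Real.pi) := by
      rw [enorm_smul, mul_comm, Real.enorm_of_nonneg (by positivity)]
    rw [← h4, h3, intervalIntegral.integral_of_le (by linarith [Real.pi_pos]),
      ← integral_Ioc_eq_integral_Ioo.symm]
    refine (enorm_integral_le_lintegral_enorm _).trans (le_of_eq ?_)
    refine lintegral_congr fun θ => ?_
    congr 2
    simp [circleMap, Complex.exp_mul_I]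
  have hm1 : Measurable fun p : ℝ × ℝ => Complex.polarCoord.symm p := by
    have : (fun p : ℝ × ℝ => Complex.polarCoord.symm p) =
        fun p => p.1 * (Real.cos p.2 + Real.sin p.2 * Complex.I) := by
      ext p; exact Complex.polarCoord_symm_apply p
    rw [this]; fun_prop
  have hm2 : Measurable fun p : ℝ × ℝ => ‖h (Complex.polarCoord.symm p)‖ₑ :=
    (hh.continuous.measurable.comp hm1).enorm
  rw [← lintegral_const_mul _ (by fun_prop), ← Complex.lintegral_comp_polarCoord_symm,
    ← Complex.lintegral_comp_polarCoord_symm]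
  have htar : polarCoord.target = Set.Ioi (0 : ℝ) ×ˢ Set.Ioo (-Real.pi) Real.pi := rfl
  rw [htar, Measure.volume_eq_prod, ← Measure.prod_restrict, lintegral_prod _ (by fun_prop),
    lintegral_prod _ (by fun_prop)]
  refine lintegral_mono fun r => ?_
  simp only [Complex.norm_polarCoord_symm, smul_eq_mul]
  have hmr : Measurable fun θ : ℝ => ‖h (Complex.polarCoord.symm (r, θ))‖ₑ :=
    hm2.comp (measurable_const.prodMk measurable_id)
  rw [lintegral_const, lintegral_const_mul _ (hmr.mul_const _), lintegral_mul_const _ hmr]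
  simp only [Measure.restrict_apply MeasurableSet.univ, Set.univ_inter, Real.volume_Ioo]
  have hr := hcirc r
  rw [show Real.pi - -Real.pi = 2 * Real.pi by ring]
  calc ENNReal.ofReal r * (‖h 0‖ₑ * ENNReal.ofReal (Real.exp (-|r| ^ 2))) *
        ENNReal.ofReal (2 * Real.pi)
      = ENNReal.ofReal r * ((‖h 0‖ₑ * ENNReal.ofReal (2 * Real.pi)) *
        ENNReal.ofReal (Real.exp (-|r| ^ 2))) := by ring
    _ ≤ _ := by gcongr

/-- The constant `∫ e^{-|z|²} dL(z)`. -/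
def gaussMass : ENNReal := ∫⁻ z : ℂ, ENNReal.ofReal (Real.exp (-‖z‖ ^ 2))

theorem gaussMass_ne_zero : gaussMass ≠ 0 := by
  unfold gaussMass
  rw [Ne, lintegral_eq_zero_iff (by fun_prop)]
  intro hz
  obtain ⟨z, hz⟩ := hz.exists
  simp only [Pi.zero_apply, ENNReal.ofReal_eq_zero] at hz
  exact absurd hz (not_le.mpr (Real.exp_pos _))

theorem gaussMass_ne_top : gaussMass ≠ ⊤ := by
  have h := mean_value_gauss (h := fun _ => 1) (differentiable_const _)
  have h2 : Integrable fun z : ℂ => Real.exp (-‖z‖ ^ 2) := by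
    have := GaussianFourier.integrable_cexp_neg_mul_sq_norm_add (V := ℂ) (b := 1)
      (by simp) 0 0
    have h3 := this.norm
    simpa [Complex.norm_exp, ← Complex.ofReal_pow] using h3
  exact (h2.lintegral_lt_top).ne

theorem sq_gaussMul_le {f : ℂ → ℂ} (hf : Differentiable ℂ f) (z : ℂ) :
    ‖gaussMul f z‖ₑ ^ 2 * gaussMass ≤ ∫⁻ w : ℂ, ‖gaussMul f w‖ₑ ^ 2 := by
  set c : ℂ := Complex.exp (-(‖z‖ : ℂ) ^ 2)
  set h : ℂ → ℂ := fun ζ => c * (f (z + ζ) * Complex.exp (-(conj z) * ζ)) ^ 2 with hh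
  have hd : Differentiable ℂ h := by
    have h1 : Differentiable ℂ fun ζ => f (z + ζ) :=
      hf.comp ((differentiable_const z).add differentiable_id)
    have h2 : Differentiable ℂ fun ζ : ℂ => Complex.exp (-(conj z) * ζ) := by fun_prop
    exact ((h1.mul h2).pow 2).const_mul c
  have key : ∀ ζ, ‖h ζ‖ₑ * ENNReal.ofReal (Real.exp (-‖ζ‖ ^ 2)) = ‖gaussMul f (ζ + z)‖ₑ ^ 2 := by
    intro ζ
    rw [← enorm_pow, ← Real.enorm_of_nonneg (Real.exp_pos _).le, ← ofReal_norm, ← ofReal_norm,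
      ← ofReal_norm, ← ENNReal.ofReal_mul (norm_nonneg _)]
    congr 1
    have hnorm : ‖ζ + z‖ ^ 2 = ‖z‖ ^ 2 + 2 * (conj z * ζ).re + ‖ζ‖ ^ 2 := by
      simp only [← Complex.normSq_eq_norm_sq, Complex.normSq_apply, Complex.mul_re,
        Complex.conj_re, Complex.conj_im, Complex.add_re, Complex.add_im]
      ring
    have hc : ‖c‖ = Real.exp (-‖z‖ ^ 2) := by
      simp [c, Complex.norm_exp, ← Complex.ofReal_pow]
    have he : ‖Complex.exp (-(conj z) * ζ)‖ = Real.exp (-(conj z * ζ).re) := by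
      rw [Complex.norm_exp, neg_mul, Complex.neg_re]
    have hg : ‖gaussMul f (ζ + z)‖ = Real.exp (-‖ζ + z‖ ^ 2 / 2) * ‖f (z + ζ)‖ := by
      rw [gaussMul, norm_mul, Complex.norm_real, Real.norm_of_nonneg (Real.exp_pos _).le,
        add_comm ζ z]
    rw [hh]
    simp only [norm_mul, norm_pow, hc, he, hg, Real.norm_of_nonneg (Real.exp_pos _).le, mul_pow,
      ← Real.exp_nat_mul]
    have : Real.exp (((2 : ℕ) : ℝ) * (-‖ζ + z‖ ^ 2 / 2)) = Real.exp (-‖z‖ ^ 2) *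
        Real.exp (((2 : ℕ) : ℝ) * (-(conj z * ζ).re)) * Real.exp (-‖ζ‖ ^ 2) := by
      rw [← Real.exp_add, ← Real.exp_add]
      congr 1
      rw [hnorm]
      push_cast
      ring
    rw [this]
    ring
  have hm := mean_value_gauss hd
  simp only [key] at hm
  have h0 : ‖h 0‖ₑ = ‖gaussMul f z‖ₑ ^ 2 := by
    have := key 0
    simpa using this
  rw [h0, lintegral_add_right_eq_self (fun w => ‖gaussMul f w‖ₑ ^ 2) z] at hm
  exact hm

/-- The sup norm is controlled by the `L²` norm on the Bargmann-Fock space. -/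
theorem exists_norm_gaussMul_le : ∃ C : ℝ, 0 ≤ C ∧ ∀ (u : L2C) (f : ℂ → ℂ), Differentiable ℂ f →
    u =ᵐ[volume] gaussMul f → ∀ z, ‖gaussMul f z‖ ≤ C * ‖u‖ := by
  refine ⟨Real.sqrt (gaussMass⁻¹).toReal, Real.sqrt_nonneg _, fun u f hf huf z => ?_⟩
  have h1 := sq_gaussMul_le hf z
  have h2 : ∫⁻ w : ℂ, ‖gaussMul f w‖ₑ ^ 2 = ENNReal.ofReal (‖u‖ ^ 2) := by
    have h3 : ∫⁻ w : ℂ, ‖gaussMul f w‖ₑ ^ 2 = ∫⁻ w : ℂ, ‖(u : ℂ → ℂ) w‖ₑ ^ 2 := by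
      refine lintegral_congr_ae ?_
      filter_upwards [huf] with w hw
      rw [hw]
    have h4 := eLpNorm_nnreal_pow_eq_lintegral (p := 2) (f := (u : ℂ → ℂ))
      (μ := (volume : Measure ℂ)) (by norm_num)
    have h5 : eLpNorm (u : ℂ → ℂ) 2 volume ^ 2 = ∫⁻ w : ℂ, ‖(u : ℂ → ℂ) w‖ₑ ^ 2 := by
      simpa only [NNReal.coe_ofNat, ENNReal.rpow_ofNat, ENNReal.coe_ofNat] using h4
    rw [h3, Lp.norm_def, ← ENNReal.toReal_pow, ENNReal.ofReal_toReal
      (ENNReal.pow_ne_top (Lp.eLpNorm_ne_top u)), h5]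
  rw [h2] at h1
  have h6 : ‖gaussMul f z‖ₑ ^ 2 ≤ ENNReal.ofReal (‖u‖ ^ 2) * gaussMass⁻¹ := by
    rw [← div_eq_mul_inv]
    exact (ENNReal.le_div_iff_mul_le (Or.inl gaussMass_ne_zero) (Or.inl gaussMass_ne_top)).2 h1
  have h7 : ‖gaussMul f z‖ ^ 2 ≤ ‖u‖ ^ 2 * (gaussMass⁻¹).toReal := by
    have := ENNReal.toReal_mono (ENNReal.mul_ne_top ENNReal.ofReal_ne_top
      (ENNReal.inv_ne_top.2 gaussMass_ne_zero)) h6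
    simpa [ENNReal.toReal_mul] using this
  refine (sq_le_sq₀ (norm_nonneg _) (by positivity)).1 ?_
  rw [mul_pow, Real.sq_sqrt ENNReal.toReal_nonneg]
  linarith

theorem isClosed_bargmannFock : IsClosed (BargmannFock : Set L2C) := by
  obtain ⟨C, hC, hb⟩ := exists_norm_gaussMul_le
  refine IsSeqClosed.isClosed fun u v hu huv => ?_
  choose f hf huf using hu
  have hdiff : ∀ m n z, dist (gaussMul (f m) z) (gaussMul (f n) z) ≤ C * dist (u m) (u n) := by
    intro m n z
    have h1 := hb (u m - u n) (fun z => f m z - f n z) ((hf m).sub (hf n)) (by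
      filter_upwards [Lp.coeFn_sub (u m) (u n), huf m, huf n] with w hw h1 h2
      rw [hw, Pi.sub_apply, h1, h2, gaussMul, gaussMul, gaussMul, mul_sub]) z
    rw [dist_eq_norm, dist_eq_norm]
    refine le_trans (le_of_eq ?_) h1
    rw [gaussMul, gaussMul, gaussMul, mul_sub]
  have hcau : UniformCauchySeqOn (fun n => gaussMul (f n)) atTop Set.univ := by
    rw [Metric.uniformCauchySeqOn_iff]
    intro ε hε
    have hc := huv.cauchySeq
    rw [Metric.cauchySeq_iff] at hc
    obtain ⟨N, hN⟩ := hc (ε / (C + 1)) (by positivity)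
    refine ⟨N, fun m hm n hn z _ => ?_⟩
    calc _ ≤ C * dist (u m) (u n) := hdiff m n z
      _ ≤ (C + 1) * dist (u m) (u n) := by gcongr; linarith
      _ < (C + 1) * (ε / (C + 1)) := by gcongr; exact hN m hm n hn
      _ = ε := by field_simp
  have hlim : ∀ z, ∃ l, Tendsto (fun n => gaussMul (f n) z) atTop (𝓝 l) := fun z =>
    cauchySeq_tendsto_of_complete (hcau.cauchySeq (Set.mem_univ z))
  choose G hG using hlim
  have hunif : TendstoUniformlyOn (fun n => gaussMul (f n)) G atTop Set.univ :=
    hcau.tendstoUniformlyOn_of_tendsto fun z _ => hG z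
  set g : ℂ → ℂ := fun z => (Real.exp (‖z‖ ^ 2 / 2) : ℂ) * G z with hg
  have hexp : ∀ z : ℂ, (Real.exp (‖z‖ ^ 2 / 2) : ℂ) * (Real.exp (-‖z‖ ^ 2 / 2) : ℂ) = 1 := by
    intro z
    rw [← Complex.ofReal_mul, ← Real.exp_add]
    norm_num [neg_div]
  have hfg : ∀ n z, f n z = (Real.exp (‖z‖ ^ 2 / 2) : ℂ) * gaussMul (f n) z := by
    intro n z
    rw [gaussMul, ← mul_assoc, hexp, one_mul]
  have hgG : ∀ z, gaussMul g z = G z := by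
    intro z
    rw [gaussMul, hg]
    simp only []
    rw [← mul_assoc, mul_comm (_ : ℂ) (Real.exp (‖z‖ ^ 2 / 2) : ℂ), hexp, one_mul]
  have hloc : TendstoLocallyUniformlyOn f g atTop Set.univ := by
    rw [tendstoLocallyUniformlyOn_iff_forall_isCompact isOpen_univ]
    intro K _ hK
    rw [Metric.tendstoUniformlyOn_iff] at hunif ⊢
    intro ε hε
    obtain ⟨M, hM⟩ := hK.exists_bound_of_continuousOn
      (f := fun z : ℂ => Real.exp (‖z‖ ^ 2 / 2)) (by fun_prop)
    have hM' : 0 < |M| + 1 := by positivity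
    filter_upwards [hunif (ε / (|M| + 1)) (by positivity)] with n hn z hz
    rw [hg, hfg n z, dist_eq_norm, ← mul_sub, norm_mul, Complex.norm_real, ← dist_eq_norm]
    calc _ ≤ (|M| + 1) * dist (G z) (gaussMul (f n) z) := by
          gcongr
          have := hM z hz
          have h2 := le_abs_self M
          linarith
      _ < (|M| + 1) * (ε / (|M| + 1)) := by gcongr; exact hn z (Set.mem_univ z)
      _ = ε := by field_simp
  have hgd : Differentiable ℂ g := by
    rw [← differentiableOn_univ]
    exact hloc.differentiableOn (Eventually.of_forall fun n => (hf n).differentiableOn)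
      isOpen_univ
  refine ⟨g, hgd, ?_⟩
  have hmeas := tendstoInMeasure_of_tendsto_Lp huv
  obtain ⟨ns, hns, hae⟩ := hmeas.exists_seq_tendsto_ae
  have hall : ∀ᵐ z : ℂ, ∀ n, (u n : ℂ → ℂ) z = gaussMul (f n) z := ae_all_iff.2 huf
  filter_upwards [hae, hall] with z hz hz2
  rw [hgG]
  refine tendsto_nhds_unique hz ?_
  simp only [hz2]
  exact (hG z).comp hns.tendsto_atTop

instance : CompleteSpace BargmannFock :=
  isClosed_bargmannFock.completeSpace_coe

/-- The orthogonal projection `Π` of `L²(ℂ)` onto the Bargmann-Fock space. -/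
def proj : L2C →L[ℂ] BargmannFock := BargmannFock.orthogonalProjectionOnto

/-- The function on `ℂ` underlying an element of the Bargmann-Fock space. -/
def toFun (u : BargmannFock) : ℂ → ℂ := (u : L2C)

theorem memLp_toFun_top (u : BargmannFock) : MemLp (toFun u) ⊤ (volume : Measure ℂ) := by
  obtain ⟨C, hC, hb⟩ := exists_norm_gaussMul_le
  obtain ⟨f, hf, huf⟩ := u.2
  refine memLp_top_of_bound (Lp.aestronglyMeasurable _) (C * ‖(u : L2C)‖) ?_
  filter_upwards [huf] with z hz
  rw [toFun, hz]
  exact hb u f hf huf z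

theorem memLp_cubic (v u : BargmannFock) :
    MemLp (fun z => (‖toFun v z‖ : ℂ) ^ 2 * toFun u z) 2 (volume : Measure ℂ) := by
  have hv : MemLp (fun z => (‖toFun v z‖ : ℂ)) ⊤ (volume : Measure ℂ) :=
    (memLp_toFun_top v).norm.ofReal
  have hu : MemLp (toFun u) 2 (volume : Measure ℂ) := Lp.memLp (u : L2C)
  have h1 := (hu.mul (r := 2) hv).mul (r := 2) hv
  refine h1.ae_eq (Eventually.of_forall fun z => ?_)
  simp only [Pi.mul_apply]
  ring

/-- The nonlinearity `Π(|v|² u)`. -/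
def nonlin (v u : BargmannFock) : BargmannFock := proj (memLp_cubic v u).toLp

/-- `(u, v) : ℝ → ℰ × ℰ` is a solution of `i ∂ₜ u = Π(|v|² u)`, `i ∂ₜ v = σ Π(|u|² v)` on the whole
time axis, with initial condition `(u(0), v(0)) = U₀`. The time derivatives are derivatives
of functions with values in the normed space `ℰ`. -/
def IsSolution (σ : ℝ) (U₀ : BargmannFock × BargmannFock)
    (U : ℝ → BargmannFock × BargmannFock) : Prop :=
  U 0 = U₀ ∧ ∀ t : ℝ, ∃ u' v' : BargmannFock,
    HasDerivAt (fun s => (U s).1) u' t ∧ HasDerivAt (fun s => (U s).2) v' t ∧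
    Complex.I • u' = nonlin (U t).2 (U t).1 ∧
    Complex.I • v' = (σ : ℂ) • nonlin (U t).1 (U t).2

/-- The mass `M(u) = ∫ |u|² dL`. -/
def mass (u : BargmannFock) : ℝ := ∫ z : ℂ, ‖toFun u z‖ ^ 2

/-- The Hamiltonian `ℋ(u, v) = ∫ |u|² |v|² dL`. -/
def hamiltonian (u v : BargmannFock) : ℝ := ∫ z : ℂ, ‖toFun u z‖ ^ 2 * ‖toFun v z‖ ^ 2

/-- The angular momentum `P_σ(u, v) = ∫ (|z|² - 1)(|u|² + σ |v|²) dL`. -/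
def angularMomentum (σ : ℝ) (u v : BargmannFock) : ℝ :=
  ∫ z : ℂ, (‖z‖ ^ 2 - 1) * (‖toFun u z‖ ^ 2 + σ * ‖toFun v z‖ ^ 2)

/-- The magnetic momentum `Q_σ(u, v) = ∫ z (|u|² + σ |v|²) dL`. -/
def magneticMomentum (σ : ℝ) (u v : BargmannFock) : ℂ :=
  ∫ z : ℂ, z * ((‖toFun u z‖ ^ 2 + σ * ‖toFun v z‖ ^ 2 : ℝ) : ℂ)

/-- `⟨z⟩^s u ∈ L²(ℂ)`, where `⟨z⟩ = (1 + |z|²)^{1/2}`. -/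
def WeightedL2 (s : ℝ) (u : BargmannFock) : Prop :=
  MemLp (fun z : ℂ => ((Real.sqrt (1 + ‖z‖ ^ 2) ^ s : ℝ) : ℂ) * toFun u z) 2 volume

/-- `z u ∈ L²(ℂ)`. -/
def MomentL2 (u : BargmannFock) : Prop :=
  MemLp (fun z : ℂ => z * toFun u z) 2 volume

end LLL

end

/-! The mean value property gives a bound of the sup norm by the `L²` norm on `ℰ`, so the right-hand
side of the system is the diagonal of a bounded real-trilinear map on `ℰ × ℰ`. Pairing `u` with `-i
Π(|v|² u)` gives `-i` times the Hamiltonian, which is real, so each `L²` norm is conserved. Local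
solutions are therefore global, and uniqueness follows from the Lipschitz bound on balls.

Smoothness of the flow uses only that the field is cubic and conserves the norm. The inverse
function theorem for the integral equation gives analyticity at time `0` and datum `0`; the scaling
`u(t) ↦ c u(c² t)` carries it to arbitrary balls for short times, and the group law to all times
(`ConservesNorm.contDiff_flow`).

Weights propagate because `Π` has the reproducing kernel, of modulus a Gaussian in `z - ζ`: moving
`⟨z⟩^s` across it costs only part of that Gaussian, and Young's inequality bounds `Π` in weighted
`L²` (`exists_norm_weightMul_proj_le`). The weighted norm of `u` then satisfies a linear Grönwall
inequality. Truncating the weight keeps all norms finite, with constants independent of the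
truncation.

For the momenta, set `D u = e^{-|z|²/2}(∂f - z̄ f)` when `u = e^{-|z|²/2} f`. The function `conj(ab)
c d` is `e^{-2|z|²}` times an antiholomorphic and a holomorphic factor, and its `∂̄` derivative is
`conj(Da b + a Db) c d`, which thus has integral zero (`integral_conj_covDeriv_mul`). Tested on the
kernel, this gives `z Π(|v|² u) = Π(|v|² z u - conj(Dv) v u)`. The time derivatives of `⟨u, zu⟩` and
`‖zu‖²` then involve only `conj(Dv) v u`. The contributions of the two equations cancel by the same
identity, and `σ² = 1` gives both of them the same coefficient. -/

set_option maxSynthPendingDepth 3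

noncomputable section

namespace LLL

/-! ### Global integral curves of norm-conserving cubic vector fields -/

section CubicFlow

variable {X : Type*} [NormedAddCommGroup X] [NormedSpace ℝ X]

/-- A globally bounded field leaves no constraint on the Picard–Lindelöf interval: a ball of radius
`L (n + 1)` suffices for the times `|t| ≤ n + 1`. The solutions on growing intervals agree by
uniqueness and are glued. -/
theorem exists_integralCurve_of_lipschitz_of_bounded [CompleteSpace X] {G : X → X} {K L : NNReal}
    (hK : LipschitzWith K G) (hL : ∀ x, ‖G x‖ ≤ L) (x : X) :
    ∃ α : ℝ → X, α 0 = x ∧ ∀ t, HasDerivAt α (G (α t)) t := by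
  have key : ∀ n : ℕ, ∃ α : ℝ → X, α 0 = x ∧
      ∀ t ∈ Set.Ioo (-(n + 1 : ℝ)) (n + 1), HasDerivAt α (G (α t)) t := by
    intro n
    have hn := n.cast_nonneg (α := ℝ)
    have h0 : (0 : ℝ) ∈ Set.Icc (-(n + 1 : ℝ)) (n + 1) := ⟨by linarith, by linarith⟩
    have hp : IsPicardLindelof (fun _ => G) (⟨0, h0⟩ : Set.Icc (-(n + 1 : ℝ)) (n + 1)) x
        (L * (n + 1)) 0 L K :=
      { lipschitzOnWith := fun _ _ => hK.lipschitzOnWith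
        continuousOn := fun _ _ => continuousOn_const
        norm_le := fun _ _ y _ => hL y
        mul_max_le := by simp }
    obtain ⟨α, h1, h2⟩ := hp.exists_eq_forall_mem_Icc_hasDerivWithinAt₀
    exact ⟨α, h1, fun t ht =>
      (h2 t (Set.Ioo_subset_Icc_self ht)).hasDerivAt (Icc_mem_nhds ht.1 ht.2)⟩
  choose α h0 hα using key
  have hcons : ∀ m n, m ≤ n → Set.EqOn (α m) (α n) (Set.Ioo (-(m + 1 : ℝ)) (m + 1)) := by
    intro m n hmn
    have hm := m.cast_nonneg (α := ℝ)
    have hmn' : (m : ℝ) ≤ n := by exact_mod_cast hmn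
    exact ODE_solution_unique_of_mem_Ioo (v := fun _ => G) (s := fun _ => Set.univ) (K := K)
      (t₀ := 0) (fun _ _ => hK.lipschitzOnWith) ⟨by linarith, by linarith⟩
      (fun t ht => ⟨hα m t ht, trivial⟩)
      (fun t ht => ⟨hα n t ⟨by linarith [ht.1], by linarith [ht.2]⟩, trivial⟩) (by rw [h0, h0])
  -- The index `⌊|t|⌋₊` may jump at `t`, so near `t` the glued curve is compared with the single
  -- solution of index `⌊|t|⌋₊ + 1`.
  refine ⟨fun t => α ⌊|t|⌋₊ t, by simp [h0], fun t => ?_⟩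
  have hfl : ∀ s : ℝ, s ∈ Set.Ioo (-(⌊|s|⌋₊ + 1 : ℝ)) (⌊|s|⌋₊ + 1) := fun s =>
    abs_lt.1 (Nat.lt_floor_add_one |s|)
  have hev : (fun s => α ⌊|s|⌋₊ s) =ᶠ[𝓝 t] α (⌊|t|⌋₊ + 1) := by
    have : ∀ᶠ s in 𝓝 t, |s| < |t| + 1 :=
      continuous_abs.continuousAt.eventually_lt continuousAt_const (by linarith)
    filter_upwards [this] with s hs
    refine hcons _ _ ?_ (hfl s)
    rw [← Nat.floor_add_one (abs_nonneg t)]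
    exact Nat.floor_le_floor hs.le
  have ht := hfl t
  have h1 := hα (⌊|t|⌋₊ + 1) t ⟨by push_cast; linarith [ht.1], by push_cast; linarith [ht.2]⟩
  rw [← hev.self_of_nhds] at h1
  exact h1.congr_of_eventuallyEq hev

/-- The radial retraction onto the closed ball of radius `R`. -/
def radialRetraction (R : ℝ) (x : X) : X := (R / max R ‖x‖) • x

theorem norm_radialRetraction_le {R : ℝ} (hR : 0 < R) (x : X) : ‖radialRetraction R x‖ ≤ R := by
  have hm : 0 < max R ‖x‖ := lt_max_of_lt_left hR
  rw [radialRetraction, norm_smul, Real.norm_of_nonneg (by positivity), div_mul_eq_mul_div,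
    div_le_iff₀ hm]
  gcongr
  exact le_max_right _ _

theorem radialRetraction_of_norm_le {R : ℝ} (hR : 0 < R) {x : X} (hx : ‖x‖ ≤ R) :
    radialRetraction R x = x := by
  rw [radialRetraction, max_eq_left hx, div_self hR.ne', one_smul]

/-- In a general normed space the argument gives constant `2`: the difference is a scalar at most
`1` times a sum of two vectors, one for the change of point and one for the change of scaling
factor, each of norm at most `‖x - y‖`. -/
theorem lipschitzWith_radialRetraction {R : ℝ} (hR : 0 < R) :
    LipschitzWith 2 (radialRetraction R : X → X) := by
  refine LipschitzWith.of_dist_le_mul fun x y => ?_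
  have hx : 0 < max R ‖x‖ := lt_max_of_lt_left hR
  have hy : 0 < max R ‖y‖ := lt_max_of_lt_left hR
  have hxy : |max R ‖y‖ - max R ‖x‖| ≤ ‖x - y‖ := by
    rw [abs_sub_comm]
    refine (abs_max_sub_max_le_max R ‖x‖ R ‖y‖).trans ?_
    simpa using abs_norm_sub_norm_le x y
  have e : radialRetraction R x - radialRetraction R y =
      (R / max R ‖x‖) • ((x - y) + ((max R ‖y‖ - max R ‖x‖) / max R ‖y‖) • y) := by
    simp only [radialRetraction, smul_add, smul_sub, smul_smul]
    have : R / max R ‖x‖ * ((max R ‖y‖ - max R ‖x‖) / max R ‖y‖) =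
        R / max R ‖x‖ - R / max R ‖y‖ := by
      field_simp
    rw [this, sub_smul]
    abel
  rw [dist_eq_norm, dist_eq_norm, e, norm_smul, Real.norm_of_nonneg (by positivity)]
  have h1 : R / max R ‖x‖ ≤ 1 := (div_le_one hx).2 (le_max_left _ _)
  have h2 : ‖((max R ‖y‖ - max R ‖x‖) / max R ‖y‖) • y‖ ≤ ‖x - y‖ := by
    rw [norm_smul, norm_div, Real.norm_eq_abs, Real.norm_of_nonneg hy.le, div_mul_eq_mul_div,
      div_le_iff₀ hy]
    exact mul_le_mul hxy (le_max_right _ _) (norm_nonneg _) (norm_nonneg _)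
  calc _ ≤ 1 * (‖x - y‖ + ‖x - y‖) := by
        gcongr
        exact (norm_add_le _ _).trans (by gcongr)
    _ = _ := by push_cast; ring

variable (M : X →L[ℝ] X →L[ℝ] X →L[ℝ] X)

theorem norm_cubic_sub_le {R : ℝ} {x y : X} (hx : ‖x‖ ≤ R) (hy : ‖y‖ ≤ R) :
    ‖M x x x - M y y y‖ ≤ 3 * ‖M‖ * R ^ 2 * ‖x - y‖ := by
  have hR : 0 ≤ R := (norm_nonneg x).trans hx
  have e : M x x x - M y y y = M (x - y) x x + M y (x - y) x + M y y (x - y) := by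
    simp only [map_sub, sub_apply]
    abel
  have hb : ∀ a b c : X, ‖M a b c‖ ≤ ‖M‖ * ‖a‖ * ‖b‖ * ‖c‖ := fun a b c =>
    ((M a).le_opNorm₂ b c).trans (by gcongr; exact M.le_opNorm a)
  rw [e]
  calc _ ≤ ‖M (x - y) x x‖ + ‖M y (x - y) x‖ + ‖M y y (x - y)‖ := norm_add₃_le
    _ ≤ ‖M‖ * ‖x - y‖ * R * R + ‖M‖ * R * ‖x - y‖ * R + ‖M‖ * R * R * ‖x - y‖ := by
        gcongr
        · exact (hb _ _ _).trans (by gcongr)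
        · exact (hb _ _ _).trans (by gcongr)
        · exact (hb _ _ _).trans (by gcongr)
    _ = _ := by ring

theorem lipschitzOnWith_cubic (R : NNReal) :
    LipschitzOnWith (3 * ‖M‖₊ * R ^ 2) (fun x => M x x x) (Metric.closedBall 0 R) := by
  refine LipschitzOnWith.of_dist_le_mul fun x hx y hy => ?_
  rw [dist_eq_norm, dist_eq_norm]
  exact norm_cubic_sub_le M (by simpa using hx) (by simpa using hy)

/-- The norm is constant along the integral curves of every time-dependent real multiple of the
cubic vector field `x ↦ M x x x`. -/
def ConservesNorm : Prop :=
  ∀ (c : ℝ → ℝ) (α : ℝ → X), (∀ t, HasDerivAt α (c t • M (α t) (α t) (α t)) t) →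
    ∀ t, ‖α t‖ = ‖α 0‖

variable {M}

theorem ConservesNorm.norm_eq (hM : ConservesNorm M) {α : ℝ → X}
    (hα : ∀ t, HasDerivAt α (M (α t) (α t) (α t)) t) (t : ℝ) : ‖α t‖ = ‖α 0‖ :=
  hM (fun _ => 1) α (by simpa using hα) t

/-- Precomposing the cubic field with a radial retraction makes it bounded and Lipschitz. By
homogeneity the truncated field is a scalar multiple of the original one, the scalar depending on
time along a curve; this is why norm conservation is required for all such multiples. The truncated
curve thus stays in the ball where nothing has been truncated. -/
theorem ConservesNorm.exists_integralCurve [CompleteSpace X] (hM : ConservesNorm M) (x : X) :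
    ∃ α : ℝ → X, α 0 = x ∧ ∀ t, HasDerivAt α (M (α t) (α t) (α t)) t := by
  -- The added `1` keeps the radius positive when `x = 0`.
  set R : NNReal := ‖x‖₊ + 1 with hRdef
  have hR : (0 : ℝ) < R := by rw [hRdef]; push_cast; positivity
  set G : X → X := fun y => (fun x => M x x x) (radialRetraction R y) with hG
  have hmaps : Set.MapsTo (radialRetraction (R : ℝ) : X → X) Set.univ (Metric.closedBall 0 R) :=
    fun y _ => by simpa using norm_radialRetraction_le hR y
  have hK : LipschitzWith (3 * ‖M‖₊ * R ^ 2 * 2) G := by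
    rw [← lipschitzOnWith_univ]
    exact (lipschitzOnWith_cubic M R).comp (lipschitzWith_radialRetraction hR).lipschitzOnWith hmaps
  have hL : ∀ y, ‖G y‖ ≤ (‖M‖₊ * R * R * R : NNReal) := fun y => by
    have h1 := norm_radialRetraction_le hR y
    calc ‖G y‖ ≤ ‖M‖ * ‖radialRetraction (R : ℝ) y‖ * ‖radialRetraction (R : ℝ) y‖ *
          ‖radialRetraction (R : ℝ) y‖ :=
          ((M _).le_opNorm₂ _ _).trans (by gcongr; exact M.le_opNorm _)
      _ ≤ _ := by push_cast; gcongr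
  obtain ⟨α, h0, hα⟩ := exists_integralCurve_of_lipschitz_of_bounded hK hL x
  have hc : ∀ t, HasDerivAt α (((R : ℝ) / max (R : ℝ) ‖α t‖) ^ 3 • M (α t) (α t) (α t)) t := by
    intro t
    have h1 := hα t
    simp only [hG, radialRetraction, map_smul, smul_apply, smul_smul] at h1
    convert h1 using 2
    ring
  refine ⟨α, h0, fun t => ?_⟩
  have hn : ‖α t‖ ≤ R := by
    rw [hM _ α hc t, h0, hRdef]
    push_cast
    linarith
  have h1 := hα t
  simpa only [hG, radialRetraction_of_norm_le hR hn] using h1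

theorem ConservesNorm.eq_of_eq_zero (hM : ConservesNorm M) {α β : ℝ → X}
    (hα : ∀ t, HasDerivAt α (M (α t) (α t) (α t)) t)
    (hβ : ∀ t, HasDerivAt β (M (β t) (β t) (β t)) t) (h : α 0 = β 0) : α = β := by
  refine ODE_solution_unique_univ (v := fun _ x => M x x x)
    (s := fun _ => Metric.closedBall 0 ‖α 0‖₊) (t₀ := 0)
    (fun _ => lipschitzOnWith_cubic M ‖α 0‖₊) (fun t => ⟨hα t, ?_⟩) (fun t => ⟨hβ t, ?_⟩) h
  · simpa using (hM.norm_eq hα t).le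
  · simpa [h] using (hM.norm_eq hβ t).le

end CubicFlow

/-! ### Analyticity of the flow in time and initial datum -/

section CubicFlow

variable {X Y : Type*} [NormedAddCommGroup X] [NormedSpace ℝ X]
  [NormedAddCommGroup Y] [NormedSpace ℝ Y]

/-- Pointwise evaluation of a continuous family of continuous linear maps. -/
def pointwiseEval (α X Y : Type*) [TopologicalSpace α] [CompactSpace α]
    [NormedAddCommGroup X] [NormedSpace ℝ X] [NormedAddCommGroup Y] [NormedSpace ℝ Y] :
    C(α, X →L[ℝ] Y) →L[ℝ] C(α, X) →L[ℝ] C(α, Y) :=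
  LinearMap.mkContinuous₂
    (LinearMap.mk₂ ℝ (fun f g => ⟨fun a => f a (g a), by fun_prop⟩)
      (fun _ _ _ => by ext; simp) (fun _ _ _ => by ext; simp)
      (fun _ _ _ => by ext; simp) (fun _ _ _ => by ext; simp)) 1 fun f g => by
    rw [one_mul, ContinuousMap.norm_le _ (by positivity)]
    intro a
    refine ((f a).le_opNorm (g a)).trans ?_
    gcongr
    · exact f.norm_coe_le_norm a
    · exact g.norm_coe_le_norm a

/-- The extension of a continuous function on `[0, 1]` that is constant on both sides. -/
theorem continuous_comp_projIcc {X : Type*} [NormedAddCommGroup X] (g : C(Set.Icc (0 : ℝ) 1, X)) :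
    Continuous fun s => g (Set.projIcc 0 1 zero_le_one s) :=
  g.continuous.comp continuous_projIcc

/-- The primitive vanishing at `0` of a continuous function on `[0, 1]`. -/
def primitive (X : Type*) [NormedAddCommGroup X] [NormedSpace ℝ X] :
    C(Set.Icc (0 : ℝ) 1, X) →L[ℝ] C(Set.Icc (0 : ℝ) 1, X) :=
  LinearMap.mkContinuous
    { toFun := fun g => ⟨fun τ => ∫ s in (0 : ℝ)..τ, g (Set.projIcc 0 1 zero_le_one s),
        (intervalIntegral.continuous_primitive
          (fun _ _ => (continuous_comp_projIcc g).intervalIntegrable _ _) 0).comp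
          continuous_subtype_val⟩
      map_add' := fun f g => by
        ext τ
        exact intervalIntegral.integral_add ((continuous_comp_projIcc f).intervalIntegrable _ _)
          ((continuous_comp_projIcc g).intervalIntegrable _ _)
      map_smul' := fun c g => by
        ext τ
        exact intervalIntegral.integral_smul c _ } 1 fun g => by
    rw [one_mul, ContinuousMap.norm_le _ (norm_nonneg _)]
    intro τ
    refine (intervalIntegral.norm_integral_le_of_norm_le_const
      (fun s _ => g.norm_coe_le_norm _)).trans ?_
    rw [sub_zero, abs_of_nonneg τ.2.1]
    exact mul_le_of_le_one_right (norm_nonneg _) τ.2.2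

theorem primitive_apply (g : C(Set.Icc (0 : ℝ) 1, X)) (τ : Set.Icc (0 : ℝ) 1) :
    primitive X g τ = ∫ s in (0 : ℝ)..τ, g (Set.projIcc 0 1 zero_le_one s) := rfl

variable (M : X →L[ℝ] X →L[ℝ] X →L[ℝ] X)

/-- The superposition operator of the cubic map `x ↦ M x x x`. -/
def cubicSuperposition (y : C(Set.Icc (0 : ℝ) 1, X)) : C(Set.Icc (0 : ℝ) 1, X) :=
  pointwiseEval _ X X (pointwiseEval _ X (X →L[ℝ] X) (M.compLeftContinuous ℝ _ y) y) y

theorem cubicSuperposition_apply (y : C(Set.Icc (0 : ℝ) 1, X)) (τ : Set.Icc (0 : ℝ) 1) :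
    cubicSuperposition M y τ = M (y τ) (y τ) (y τ) := rfl

/-- The superposition operator is built from bounded linear and bilinear maps between spaces of
continuous functions, so it is polynomial in `y`. -/
theorem contDiff_cubicSuperposition : ContDiff ℝ ω (cubicSuperposition M) := by
  have h1 : ContDiff ℝ ω fun y : C(Set.Icc (0 : ℝ) 1, X) => M.compLeftContinuous ℝ _ y :=
    ContinuousLinearMap.contDiff _
  unfold cubicSuperposition
  fun_prop

/-- The map whose zeros in the last variable are the integral curves, in rescaled time. -/
def integralEquation (p : ℝ × X × C(Set.Icc (0 : ℝ) 1, X)) : ℝ × X × C(Set.Icc (0 : ℝ) 1, X) :=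
  (p.1, p.2.1, p.2.2 - p.1 • primitive X
    (cubicSuperposition M (p.2.2 + ContinuousLinearMap.const ℝ _ p.2.1)))

theorem contDiff_integralEquation : ContDiff ℝ ω (integralEquation M) := by
  have h := contDiff_cubicSuperposition M
  unfold integralEquation
  fun_prop

/-- The nonlinear term is a product of `t` with a smooth function; both factors vanish at the
origin, so it does not contribute to the derivative. -/
theorem hasFDerivAt_integralEquation_zero :
    HasFDerivAt (integralEquation M)
      (ContinuousLinearEquiv.refl ℝ (ℝ × X × C(Set.Icc (0 : ℝ) 1, X)) :
        (ℝ × X × C(Set.Icc (0 : ℝ) 1, X)) →L[ℝ] (ℝ × X × C(Set.Icc (0 : ℝ) 1, X))) 0 := by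
  set H : ℝ × X × C(Set.Icc (0 : ℝ) 1, X) → C(Set.Icc (0 : ℝ) 1, X) := fun p => primitive X
    (cubicSuperposition M (p.2.2 + ContinuousLinearMap.const ℝ _ p.2.1)) with hH
  have hHd : ContDiff ℝ ω H := by
    have h := contDiff_cubicSuperposition M
    fun_prop
  have hH0 : H 0 = 0 := by
    simp [hH, cubicSuperposition]
  have h1 : HasFDerivAt H (fderiv ℝ H 0) 0 :=
    (hHd.differentiable (by simp) 0).hasFDerivAt
  have h2 : HasFDerivAt (fun p : ℝ × X × C(Set.Icc (0 : ℝ) 1, X) => p.1)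
    (ContinuousLinearMap.fst ℝ _ _) 0 := hasFDerivAt_fst
  have h3 := h2.smul h1
  have h4 : HasFDerivAt (fun p : ℝ × X × C(Set.Icc (0 : ℝ) 1, X) => p.2.1)
    ((ContinuousLinearMap.fst ℝ _ _).comp (ContinuousLinearMap.snd ℝ _ _)) 0 :=
    hasFDerivAt_fst.comp _ hasFDerivAt_snd
  have h5 : HasFDerivAt (fun p : ℝ × X × C(Set.Icc (0 : ℝ) 1, X) => p.2.2)
    ((ContinuousLinearMap.snd ℝ _ _).comp (ContinuousLinearMap.snd ℝ _ _)) 0 :=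
    hasFDerivAt_snd.comp _ hasFDerivAt_snd
  have h6 := h2.prodMk (h4.prodMk (h5.sub h3))
  refine h6.congr_fderiv ?_
  ext p <;> simp [hH0]

variable {M}

/-- The global flow of a norm-conserving cubic vector field. -/
def ConservesNorm.flow [CompleteSpace X] (hM : ConservesNorm M) (t : ℝ) (x : X) : X :=
  (hM.exists_integralCurve x).choose t

variable [CompleteSpace X] (hM : ConservesNorm M)

theorem ConservesNorm.flow_zero (x : X) : hM.flow 0 x = x :=
  (hM.exists_integralCurve x).choose_spec.1

theorem ConservesNorm.hasDerivAt_flow (x : X) (t : ℝ) :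
    HasDerivAt (fun s => hM.flow s x) (M (hM.flow t x) (hM.flow t x) (hM.flow t x)) t :=
  (hM.exists_integralCurve x).choose_spec.2 t

theorem ConservesNorm.norm_flow (t : ℝ) (x : X) : ‖hM.flow t x‖ = ‖x‖ := by
  rw [hM.norm_eq (hM.hasDerivAt_flow x) t, hM.flow_zero]

theorem ConservesNorm.eq_flow {α : ℝ → X} (hα : ∀ t, HasDerivAt α (M (α t) (α t) (α t)) t) :
    α = fun t => hM.flow t (α 0) :=
  hM.eq_of_eq_zero hα (hM.hasDerivAt_flow _) (hM.flow_zero _).symm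

theorem ConservesNorm.flow_add (s t : ℝ) (x : X) :
    hM.flow (s + t) x = hM.flow s (hM.flow t x) := by
  have h := hM.eq_flow (α := fun s => hM.flow (s + t) x)
    (fun s => (hM.hasDerivAt_flow x (s + t)).comp_add_const s t)
  simpa using congrFun h s

/-- Cubic homogeneity: `t ↦ c α(c² t)` is an integral curve whenever `α` is one. -/
theorem ConservesNorm.flow_smul (c t : ℝ) (x : X) :
    hM.flow t (c • x) = c • hM.flow (c ^ 2 * t) x := by
  have h := hM.eq_flow (α := fun t => c • hM.flow (c ^ 2 * t) x) (fun t => by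
    have h1 := ((hM.hasDerivAt_flow x (c ^ 2 * t)).scomp t
      ((hasDerivAt_id t).const_mul (c ^ 2))).const_smul c
    refine h1.congr_deriv ?_
    simp only [map_smul, smul_apply, smul_smul]
    congr 1
    ring)
  simpa [hM.flow_zero] using (congrFun h t).symm

/-- The orbit of `x` up to time `t`, shifted to start at the origin and parametrized by `[0, 1]`. -/
def ConservesNorm.orbitSegment (t : ℝ) (x : X) : C(Set.Icc (0 : ℝ) 1, X) :=
  ⟨fun τ => hM.flow (t * τ) x - x, by
    have h : Continuous fun s => hM.flow s x :=
      continuous_iff_continuousAt.2 fun s => (hM.hasDerivAt_flow x s).continuousAt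
    fun_prop⟩

/-- The bound does not involve `t`: small data have small orbits, which places the orbit segment in
the domain of the local inverse without prior continuity of the flow in `x`. -/
theorem ConservesNorm.norm_orbitSegment_le (t : ℝ) (x : X) :
    ‖hM.orbitSegment t x‖ ≤ 2 * ‖x‖ := by
  rw [ContinuousMap.norm_le _ (by positivity)]
  intro τ
  refine (norm_sub_le _ _).trans ?_
  rw [hM.norm_flow]
  linarith

theorem ConservesNorm.integralEquation_orbitSegment (t : ℝ) (x : X) :
    integralEquation M (t, x, hM.orbitSegment t x) = (t, x, 0) := by
  refine Prod.ext rfl (Prod.ext rfl ?_)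
  ext τ
  have hc : Continuous fun s => hM.flow s x :=
    continuous_iff_continuousAt.2 fun s => (hM.hasDerivAt_flow x s).continuousAt
  have h1 : ∀ s : ℝ, HasDerivAt (fun s => hM.flow (t * s) x)
      (t • M (hM.flow (t * s) x) (hM.flow (t * s) x) (hM.flow (t * s) x)) s := fun s => by
    simpa [Function.comp_def] using
      (hM.hasDerivAt_flow x (t * s)).scomp s ((hasDerivAt_id s).const_mul t)
  have h2 := intervalIntegral.integral_eq_sub_of_hasDerivAt (a := 0) (b := τ)
    (fun s _ => h1 s) ((by fun_prop : Continuous fun s : ℝ =>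
      t • M (hM.flow (t * s) x) (hM.flow (t * s) x) (hM.flow (t * s) x)).intervalIntegrable _ _)
  rw [mul_zero, hM.flow_zero, intervalIntegral.integral_smul] at h2
  have h3 : ∫ s in (0 : ℝ)..τ, M (hM.flow (t * s) x) (hM.flow (t * s) x) (hM.flow (t * s) x) =
      primitive X (cubicSuperposition M
        (hM.orbitSegment t x + ContinuousLinearMap.const ℝ _ x)) τ := by
    rw [primitive_apply]
    refine intervalIntegral.integral_congr fun s hs => ?_
    rw [Set.uIcc_of_le τ.2.1] at hs
    have hs' : s ∈ Set.Icc (0 : ℝ) 1 := ⟨hs.1, hs.2.trans τ.2.2⟩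
    simp [cubicSuperposition_apply, Set.projIcc_of_mem _ hs', ConservesNorm.orbitSegment]
  rw [h3] at h2
  simp only [integralEquation, ContinuousMap.sub_apply, ContinuousMap.smul_apply,
    ContinuousMap.zero_apply, h2]
  exact sub_self _

/-- Near the origin the orbit segment is recovered from `(t, x, 0)` by the analytic local inverse of
the integral equation; its value at parameter `1` is the flow minus `x`. -/
theorem ConservesNorm.contDiffAt_flow_zero :
    ContDiffAt ℝ ω (fun p : ℝ × X => hM.flow p.1 p.2) 0 := by
  have hd := (contDiff_integralEquation M).contDiffAt (x := 0)
  have hf := hasFDerivAt_integralEquation_zero M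
  have h0 : integralEquation M 0 = 0 := by simp [integralEquation, cubicSuperposition]
  have hn : (ω : WithTop ℕ∞) ≠ 0 := by simp
  have hs := hd.hasStrictFDerivAt' hf hn
  have hinv := hd.to_localInverse hf hn
  rw [h0] at hinv
  have hlim : Tendsto (fun p : ℝ × X => (p.1, p.2, hM.orbitSegment p.1 p.2)) (𝓝 0) (𝓝 0) := by
    have h1 : Tendsto (fun p : ℝ × X => hM.orbitSegment p.1 p.2) (𝓝 0) (𝓝 0) := by
      refine squeeze_zero_norm (fun p => hM.norm_orbitSegment_le p.1 p.2) ?_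
      have : Continuous fun p : ℝ × X => 2 * ‖p.2‖ := by fun_prop
      simpa using this.tendsto 0
    exact (continuous_fst.tendsto (0 : ℝ × X)).prodMk_nhds
      ((continuous_snd.tendsto (0 : ℝ × X)).prodMk_nhds h1)
  have hev := hlim.eventually hs.eventually_left_inverse
  have hcd : ContDiffAt ℝ ω (fun p : ℝ × X => p.2 +
      (hd.localInverse hf hn (p.1, p.2, 0)).2.2 ⟨1, zero_le_one, le_rfl⟩) 0 := by
    have h1 : ContDiffAt ℝ ω (fun p : ℝ × X =>
        ((p.1, p.2, 0) : ℝ × X × C(Set.Icc (0 : ℝ) 1, X))) 0 := by fun_prop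
    have h2 : ContDiffAt ℝ ω (fun p : ℝ × X => hd.localInverse hf hn (p.1, p.2, 0)) 0 :=
      ContDiffAt.comp (0 : ℝ × X) hinv h1
    have h3 := (ContinuousMap.evalCLM ℝ (⟨1, zero_le_one, le_rfl⟩ : Set.Icc (0 : ℝ) 1) :
      C(Set.Icc (0 : ℝ) 1, X) →L[ℝ] X).contDiff (n := ω).contDiffAt.comp (0 : ℝ × X) h2.snd.snd
    exact contDiffAt_snd.add h3
  refine hcd.congr_of_eventuallyEq ?_
  filter_upwards [hev] with p hp
  rw [hM.integralEquation_orbitSegment] at hp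
  change _ = p.2 + (hs.localInverse _ _ _ (p.1, p.2, 0)).2.2 _
  rw [hp]
  simp [ConservesNorm.orbitSegment]

theorem ConservesNorm.contDiffAt_flow_of_norm_lt {R : ℝ} (hR : 0 < R) :
    ∃ ε > 0, ∀ t x, |t| < ε → ‖x‖ < R →
      ContDiffAt ℝ ω (fun p : ℝ × X => hM.flow p.1 p.2) (t, x) := by
  obtain ⟨δ, hδ, h⟩ := Metric.eventually_nhds_iff.1
    (hM.contDiffAt_flow_zero.eventually (by simp))
  -- This scale sends the ball of radius `R` to that of radius `δ`; times are then divided by `c ^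
  -- 2`, whence the bound `c ^ 2 * δ` on `|t|`.
  set c : ℝ := δ / R with hc
  have hc0 : 0 < c := by positivity
  refine ⟨c ^ 2 * δ, by positivity, fun t x ht hx => ?_⟩
  have h1 := h (y := ((c ^ 2)⁻¹ * t, c • x)) (by
    rw [dist_zero_right, Prod.norm_def, max_lt_iff]
    constructor
    · rw [Real.norm_eq_abs, abs_mul, abs_of_pos (by positivity), inv_mul_lt_iff₀ (by positivity)]
      exact ht
    · rw [norm_smul, Real.norm_of_nonneg hc0.le, hc, div_mul_eq_mul_div, div_lt_iff₀ hR]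
      gcongr)
  have h2 : (fun p : ℝ × X => hM.flow p.1 p.2) = fun p : ℝ × X =>
      c⁻¹ • (fun p : ℝ × X => hM.flow p.1 p.2) ((c ^ 2)⁻¹ * p.1, c • p.2) := by
    ext p
    simp only
    rw [hM.flow_smul, smul_smul, inv_mul_cancel₀ hc0.ne', one_smul, ← mul_assoc,
      mul_inv_cancel₀ (by positivity), one_mul]
  rw [h2]
  have h3 : ContDiffAt ℝ ω (fun p : ℝ × X => ((c ^ 2)⁻¹ * p.1, c • p.2)) (t, x) := by fun_prop
  exact ContDiffAt.const_smul c⁻¹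
    (ContDiffAt.comp (g := fun p : ℝ × X => hM.flow p.1 p.2) (t, x) h1 h3)

/-- Norm conservation keeps the whole orbit in the ball of radius `‖x‖ + 1`, so the same short time
`ε` can be used at every step of the group law. -/
theorem ConservesNorm.contDiff_flow : ContDiff ℝ ω (fun p : ℝ × X => hM.flow p.1 p.2) := by
  rw [contDiff_iff_contDiffAt]
  rintro ⟨t, x⟩
  obtain ⟨ε, hε, h⟩ := hM.contDiffAt_flow_of_norm_lt (R := ‖x‖ + 1) (by positivity)
  have key : ∀ n : ℕ, ∀ t, |t| < (n + 1) * ε →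
      ContDiffAt ℝ ω (fun p : ℝ × X => hM.flow p.1 p.2) (t, x) := by
    intro n
    induction n with
    | zero => exact fun t ht => h t x (by simpa using ht) (by linarith)
    | succ n ih =>
      intro t ht
      have hn : (0 : ℝ) < n + 2 := by positivity
      -- Time is split in the proportions `1 : n + 1`: if `|t| < (n + 2) ε`, the short piece is
      -- below `ε` and the long one below `(n + 1) ε`.
      have e : (fun p : ℝ × X => hM.flow p.1 p.2) = fun p : ℝ × X =>
          (fun p : ℝ × X => hM.flow p.1 p.2)
            (p.1 / (n + 2), (fun p : ℝ × X => hM.flow p.1 p.2) ((n + 1) / (n + 2) * p.1, p.2)) := by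
        ext p
        simp only
        rw [← hM.flow_add]
        congr 1
        field_simp
        ring
      have ht' : |t| / (n + 2) < ε := by
        rw [div_lt_iff₀ hn]
        push_cast at ht
        linarith
      have h1 := h (t / (n + 2)) (hM.flow ((n + 1) / (n + 2) * t) x)
        (by rwa [abs_div, abs_of_pos hn]) (by rw [hM.norm_flow]; linarith)
      have h2 := ih ((n + 1) / (n + 2) * t) (by
        rw [abs_mul, abs_of_pos (by positivity), div_mul_eq_mul_div, mul_div_assoc]
        gcongr)
      rw [e]
      have h3 : ContDiffAt ℝ ω (fun p : ℝ × X => ((n + 1) / (n + 2) * p.1, p.2)) (t, x) := by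
        fun_prop
      have h4 : ContDiffAt ℝ ω (fun p : ℝ × X => (p.1 / (n + 2),
          (fun p : ℝ × X => hM.flow p.1 p.2) ((n + 1) / (n + 2) * p.1, p.2))) (t, x) :=
        ContDiffAt.prodMk (by fun_prop)
          (ContDiffAt.comp (g := fun p : ℝ × X => hM.flow p.1 p.2) (t, x) h2 h3)
      exact ContDiffAt.comp (g := fun p : ℝ × X => hM.flow p.1 p.2) (t, x) h1 h4
  obtain ⟨n, hn⟩ := exists_nat_gt (|t| / ε)
  refine key n t ?_
  rw [div_lt_iff₀ hε] at hn
  linarith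

end CubicFlow

/-! ### The system as a cubic field on `ℰ × ℰ`; mass and Hamiltonian -/

section Trilinear

variable {X Y Z W V : Type*} [NormedAddCommGroup X] [NormedSpace ℝ X]
  [NormedAddCommGroup Y] [NormedSpace ℝ Y] [NormedAddCommGroup Z] [NormedSpace ℝ Z]
  [NormedAddCommGroup W] [NormedSpace ℝ W] [NormedAddCommGroup V] [NormedSpace ℝ V]

/-- The trilinear map `(a, b, c) ↦ L (K (f a) (g b) (h c))`. -/
def trilinearComp (K : Y →L[ℝ] Y →L[ℝ] Z →L[ℝ] W) (f g : X →L[ℝ] Y) (h : X →L[ℝ] Z)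
    (L : W →L[ℝ] V) : X →L[ℝ] X →L[ℝ] X →L[ℝ] V :=
  (ContinuousLinearMap.compL ℝ X (Z →L[ℝ] W) (X →L[ℝ] V)
    ((ContinuousLinearMap.compL ℝ X W V L).comp
      ((ContinuousLinearMap.compL ℝ X Z W).flip h))).comp (K.bilinearComp f g)

@[simp]
theorem trilinearComp_apply (K : Y →L[ℝ] Y →L[ℝ] Z →L[ℝ] W) (f g : X →L[ℝ] Y) (h : X →L[ℝ] Z)
    (L : W →L[ℝ] V) (a b c : X) : trilinearComp K f g h L a b c = L (K (f a) (g b) (h c)) := rfl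

end Trilinear

/-- The inclusion of the Bargmann-Fock space into `L^∞`. -/
def toLinfty : BargmannFock →L[ℝ] Lp ℂ ⊤ (volume : Measure ℂ) :=
  LinearMap.mkContinuousOfExistsBound
    { toFun := fun u => (memLp_toFun_top u).toLp
      map_add' := fun u v => by
        rw [← MemLp.toLp_add]
        exact MemLp.toLp_congr _ _ (Lp.coeFn_add (u : L2C) v)
      map_smul' := fun c u => by
        simp only [RingHom.id_apply]
        rw [← MemLp.toLp_const_smul]
        exact MemLp.toLp_congr _ _ (Lp.coeFn_smul c (u : L2C)) } <| by
    obtain ⟨C, hC, hb⟩ := exists_norm_gaussMul_le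
    refine ⟨C, fun u => ?_⟩
    change ‖(memLp_toFun_top u).toLp‖ ≤ _
    rw [Lp.norm_toLp, eLpNorm_exponent_top]
    refine ENNReal.toReal_le_of_le_ofReal (by positivity) (eLpNormEssSup_le_of_ae_bound ?_)
    obtain ⟨f, hf, huf⟩ := u.2
    filter_upwards [huf] with z hz
    rw [toFun, hz]
    exact hb u f hf huf z

theorem coeFn_toLinfty (u : BargmannFock) : toLinfty u =ᵐ[volume] toFun u :=
  (memLp_toFun_top u).coeFn_toLp

/-- The complex conjugate of an element of the Bargmann-Fock space, in `L^∞`. -/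
def conjToLinfty : BargmannFock →L[ℝ] Lp ℂ ⊤ (volume : Measure ℂ) :=
  ((Complex.conjCLE : ℂ →L[ℝ] ℂ).compLpL ⊤ volume).comp toLinfty

theorem coeFn_conjToLinfty (u : BargmannFock) :
    conjToLinfty u =ᵐ[volume] fun z => conj (toFun u z) := by
  have h := ContinuousLinearMap.coeFn_compLpL (Complex.conjCLE : ℂ →L[ℝ] ℂ) (toLinfty u)
  filter_upwards [h, coeFn_toLinfty u] with z h1 h2
  change ((Complex.conjCLE : ℂ →L[ℝ] ℂ).compLpL ⊤ volume (toLinfty u)) z = _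
  rw [h1, h2]
  rfl

/-- The trilinear map `(a, b, c) ↦ a b̄ c` with values in `L²`. -/
def tripleProduct : BargmannFock →L[ℝ] BargmannFock →L[ℝ] BargmannFock →L[ℝ] L2C :=
  let B : Lp ℂ ⊤ (volume : Measure ℂ) →L[ℝ] L2C →L[ℝ] L2C :=
    (ContinuousLinearMap.mul ℝ ℂ).holderL volume ⊤ 2 2
  trilinearComp ((ContinuousLinearMap.compL ℝ L2C L2C L2C).bilinearComp B B) toLinfty conjToLinfty
    (BargmannFock.subtypeL.restrictScalars ℝ) (ContinuousLinearMap.id ℝ L2C)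

theorem coeFn_tripleProduct (a b c : BargmannFock) :
    tripleProduct a b c =ᵐ[volume] fun z => toFun a z * (conj (toFun b z) * toFun c z) := by
  have h1 := (ContinuousLinearMap.mul ℝ ℂ).coeFn_holder (r := 2) (conjToLinfty b) (c : L2C)
  have h2 := (ContinuousLinearMap.mul ℝ ℂ).coeFn_holder (r := 2) (toLinfty a)
    ((ContinuousLinearMap.mul ℝ ℂ).holder 2 (conjToLinfty b) (c : L2C))
  filter_upwards [h1, h2, coeFn_toLinfty a, coeFn_conjToLinfty b] with z h1 h2 h3 h4
  refine h2.trans ?_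
  rw [h1, h3, h4]
  rfl

theorem tripleProduct_comm (a b c : BargmannFock) : tripleProduct a b c = tripleProduct c b a := by
  refine Lp.ext ?_
  filter_upwards [coeFn_tripleProduct a b c, coeFn_tripleProduct c b a] with z h1 h2
  rw [h1, h2]
  ring

theorem nonlin_eq (v u : BargmannFock) : nonlin v u = proj (tripleProduct v v u) := by
  unfold nonlin
  congr 1
  refine Lp.ext ?_
  filter_upwards [coeFn_tripleProduct v v u, (memLp_cubic v u).coeFn_toLp] with z h1 h2
  rw [h1, h2, ← mul_assoc, Complex.mul_conj, Complex.normSq_eq_norm_sq]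
  push_cast
  rfl

theorem inner_proj (u : BargmannFock) (h : L2C) : inner ℂ u (proj h) = inner ℂ (u : L2C) h :=
  Submodule.inner_orthogonalProjectionOnto_eq_of_mem_left u h

theorem inner_tripleProduct (a b c d : BargmannFock) :
    inner ℂ (a : L2C) (tripleProduct b c d) =
      ∫ z, conj (toFun a z) * (toFun b z * (conj (toFun c z) * toFun d z)) := by
  rw [L2.inner_def]
  refine integral_congr_ae ?_
  filter_upwards [coeFn_tripleProduct b c d] with z h1
  rw [h1, RCLike.inner_apply, mul_comm]
  rfl

/-- The quartic form `∫ ā b c̄ d` is symmetric in its two conjugated entries. With the symmetry in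
`b, d` and the conjugation rule, this allows the derivative of the Hamiltonian to be grouped into
real parts. -/
theorem inner_tripleProduct_swap (a b c d : BargmannFock) :
    inner ℂ (a : L2C) (tripleProduct b c d) = inner ℂ (c : L2C) (tripleProduct b a d) := by
  rw [inner_tripleProduct, inner_tripleProduct]
  congr 1 with z
  ring

theorem conj_inner_tripleProduct (a b c d : BargmannFock) :
    conj (inner ℂ (a : L2C) (tripleProduct b c d)) = inner ℂ (b : L2C) (tripleProduct a d c) := by
  rw [inner_tripleProduct, inner_tripleProduct, ← integral_conj]
  congr 1 with z
  simp only [map_mul, Complex.conj_conj]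
  ring

theorem inner_nonlin_self (v u : BargmannFock) :
    inner ℂ (u : L2C) (tripleProduct v v u) = (hamiltonian u v : ℂ) := by
  rw [inner_tripleProduct, hamiltonian, ← integral_complex_ofReal]
  congr 1 with z
  have h1 := Complex.conj_mul' (toFun u z)
  have h2 := Complex.conj_mul' (toFun v z)
  push_cast
  rw [← h1, ← h2]
  ring

theorem integrable_hamiltonian (u v : BargmannFock) :
    Integrable fun z : ℂ => ‖toFun u z‖ ^ 2 * ‖toFun v z‖ ^ 2 := by
  have h : Integrable fun z => inner ℂ ((u : L2C) z) (tripleProduct v v u z) :=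
    L2.integrable_inner _ _
  refine h.norm.congr ?_
  filter_upwards [coeFn_tripleProduct v v u] with z h1
  rw [h1, RCLike.inner_apply]
  simp only [norm_mul, RCLike.norm_conj, toFun]
  ring

theorem mass_eq (u : BargmannFock) : mass u = ‖u‖ ^ 2 := by
  have h : inner ℂ (u : L2C) u = ∫ z, inner ℂ ((u : L2C) z) ((u : L2C) z) := L2.inner_def _ _
  have h2 : ((‖u‖ ^ 2 : ℝ) : ℂ) = ((mass u : ℝ) : ℂ) := by
    rw [mass, ← integral_complex_ofReal, ← Submodule.norm_coe]
    have h3 := inner_self_eq_norm_sq_to_K (𝕜 := ℂ) (u : L2C)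
    rw [h] at h3
    push_cast
    refine h3.symm.trans (integral_congr_ae (Eventually.of_forall fun z => ?_))
    exact inner_self_eq_norm_sq_to_K (𝕜 := ℂ) ((u : L2C) z)
  exact_mod_cast h2.symm

/-- The trilinear form of the vector field `(u, v) ↦ (-i Π(|v|² u), -i σ Π(|u|² v))`. -/
def vectorField (σ : ℝ) : (BargmannFock × BargmannFock) →L[ℝ] (BargmannFock × BargmannFock) →L[ℝ]
    (BargmannFock × BargmannFock) →L[ℝ] (BargmannFock × BargmannFock) :=
  let K := (proj.restrictScalars ℝ : L2C →L[ℝ] BargmannFock)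
  let p := ContinuousLinearMap.fst ℝ BargmannFock BargmannFock
  let q := ContinuousLinearMap.snd ℝ BargmannFock BargmannFock
  trilinearComp tripleProduct q q p ((ContinuousLinearMap.inl ℝ _ _).comp ((-Complex.I) • K)) +
  trilinearComp tripleProduct p p q ((ContinuousLinearMap.inr ℝ _ _).comp ((-Complex.I * σ) • K))

theorem vectorField_apply (σ : ℝ) (x : BargmannFock × BargmannFock) :
    vectorField σ x x x =
      ((-Complex.I) • nonlin x.2 x.1, (-Complex.I * σ) • nonlin x.1 x.2) := by
  simp [vectorField, nonlin_eq]

/-- The projection disappears when paired with an element of `ℰ`, which leaves `-i c` times the real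
Hamiltonian. -/
theorem re_inner_nonlin (v u : BargmannFock) (c : ℝ) :
    (inner ℂ u ((c : ℂ) • (-Complex.I) • nonlin v u)).re = 0 := by
  rw [inner_smul_right, inner_smul_right, nonlin_eq, inner_proj, inner_nonlin_self]
  simp

theorem norm_eq_of_hasDerivAt {u u' : ℝ → BargmannFock} (hu : ∀ t, HasDerivAt u (u' t) t)
    (h : ∀ t, (inner ℂ (u t) (u' t)).re = 0) (t : ℝ) : ‖u t‖ = ‖u 0‖ := by
  have h1 : ∀ t, HasDerivAt (fun s => inner ℂ (u s) (u s)) 0 t := fun t => by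
    refine ((hu t).inner ℂ (hu t)).congr_deriv ?_
    rw [← inner_conj_symm (u' t) (u t), Complex.add_conj, h t]
    simp
  have h2 := is_const_of_deriv_eq_zero (fun t => (h1 t).differentiableAt)
    (fun t => (h1 t).deriv) t 0
  rw [inner_self_eq_norm_sq_to_K, inner_self_eq_norm_sq_to_K] at h2
  have h3 : ‖u t‖ ^ 2 = ‖u 0‖ ^ 2 := by exact_mod_cast h2
  exact (sq_eq_sq₀ (norm_nonneg _) (norm_nonneg _)).1 h3

theorem norms_eq_of_hasDerivAt_vectorField {σ : ℝ} {c : ℝ → ℝ}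
    {α : ℝ → BargmannFock × BargmannFock}
    (hα : ∀ t, HasDerivAt α (c t • vectorField σ (α t) (α t) (α t)) t) (t : ℝ) :
    ‖(α t).1‖ = ‖(α 0).1‖ ∧ ‖(α t).2‖ = ‖(α 0).2‖ := by
  constructor
  · refine norm_eq_of_hasDerivAt (u := fun t => (α t).1) (fun t => (hα t).fst) (fun t => ?_) t
    rw [vectorField_apply]
    exact re_inner_nonlin _ _ (c t)
  · refine norm_eq_of_hasDerivAt (u := fun t => (α t).2) (fun t => (hα t).snd) (fun t => ?_) t
    rw [vectorField_apply]
    have e : c t • ((-Complex.I * σ) • nonlin (α t).1 (α t).2) =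
        ((c t * σ : ℝ) : ℂ) • (-Complex.I) • nonlin (α t).1 (α t).2 := by
      rw [RCLike.real_smul_eq_coe_smul (K := ℂ), smul_smul, smul_smul]
      congr 1
      change ((c t : ℝ) : ℂ) * (-Complex.I * σ) = _
      push_cast
      ring
    change (inner ℂ _ (c t • ((-Complex.I * σ) • nonlin (α t).1 (α t).2))).re = 0
    rw [e]
    exact re_inner_nonlin _ _ _

/-- The product carries the sup norm, so conservation of the two component norms suffices. -/
theorem conservesNorm_vectorField (σ : ℝ) : ConservesNorm (vectorField σ) := fun c α hα t => by
  have h := norms_eq_of_hasDerivAt_vectorField hα t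
  rw [Prod.norm_def, Prod.norm_def, h.1, h.2]

theorem isSolution_iff (σ : ℝ) (U₀ : BargmannFock × BargmannFock)
    (U : ℝ → BargmannFock × BargmannFock) :
    IsSolution σ U₀ U ↔ U 0 = U₀ ∧ ∀ t, HasDerivAt U (vectorField σ (U t) (U t) (U t)) t := by
  have hI : ∀ a b : BargmannFock, Complex.I • a = b ↔ a = (-Complex.I) • b := by
    intro a b
    constructor
    · rintro rfl
      simp [smul_smul]
    · rintro rfl
      simp [smul_smul]
  unfold IsSolution
  refine and_congr_right fun _ => forall_congr' fun t => ?_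
  rw [vectorField_apply]
  constructor
  · rintro ⟨u', v', hu, hv, h1, h2⟩
    rw [hI] at h1 h2
    rw [smul_smul] at h2
    subst h1 h2
    exact hu.prodMk hv
  · intro h
    refine ⟨_, _, h.fst, h.snd, ?_, ?_⟩
    · rw [hI]
    · rw [hI, smul_smul]

theorem hasDerivAt_components {σ : ℝ} {α : ℝ → BargmannFock × BargmannFock} {t : ℝ}
    (hα : HasDerivAt α (vectorField σ (α t) (α t) (α t)) t) :
    HasDerivAt (fun s => (α s).1) ((-Complex.I) • nonlin (α t).2 (α t).1) t ∧
      HasDerivAt (fun s => (α s).2) ((-Complex.I * σ) • nonlin (α t).1 (α t).2) t := by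
  rw [vectorField_apply] at hα
  exact ⟨hα.fst, hα.snd⟩

/-- The Hamiltonian is constant along solutions. -/
theorem hamiltonian_eq_of_hasDerivAt {σ : ℝ} {α : ℝ → BargmannFock × BargmannFock}
    (hα : ∀ t, HasDerivAt α (vectorField σ (α t) (α t) (α t)) t) (t : ℝ) :
    hamiltonian (α t).1 (α t).2 = hamiltonian (α 0).1 (α 0).2 := by
  have h1 : ∀ t, HasDerivAt (fun s => (hamiltonian (α s).1 (α s).2 : ℂ)) 0 t := fun t => by
    obtain ⟨hu, hv⟩ := hasDerivAt_components (hα t)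
    set u := (α t).1 with hut
    set v := (α t).2 with hvt
    set u' : BargmannFock := (-Complex.I) • nonlin v u with hu'
    set v' : BargmannFock := (-Complex.I * σ) • nonlin u v with hv'
    have hT : HasDerivAt (fun s => tripleProduct (α s).2 (α s).2 (α s).1)
        (tripleProduct v' v u + tripleProduct v v' u + tripleProduct v v u') t := by
      have e := ((tripleProduct.hasFDerivAt.comp_hasDerivAt t hv).clm_apply hv).clm_apply hu
      exact e
    have hu2 : HasDerivAt (fun s => ((α s).1 : L2C)) (u' : L2C) t :=
      (BargmannFock.subtypeL.restrictScalars ℝ).hasFDerivAt.comp_hasDerivAt t hu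
    have hd := hu2.inner ℂ hT
    simp only [inner_nonlin_self] at hd
    refine hd.congr_deriv ?_
    rw [inner_add_right, inner_add_right, ← hut, ← hvt]
    have e1 : inner ℂ (u : L2C) (tripleProduct v v u') =
        conj (inner ℂ (u' : L2C) (tripleProduct v v u)) := by
      rw [conj_inner_tripleProduct, tripleProduct_comm, inner_tripleProduct_swap]
    have e2 : inner ℂ (u : L2C) (tripleProduct v v' u) =
        inner ℂ (v' : L2C) (tripleProduct u u v) := by
      rw [inner_tripleProduct_swap, tripleProduct_comm]
    have e3 : inner ℂ (u : L2C) (tripleProduct v' v u) =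
        conj (inner ℂ (v' : L2C) (tripleProduct u u v)) := by
      rw [conj_inner_tripleProduct]
    -- As `u' = -i Π(|v|² u)`, this pairing is `i ‖Π(|v|² u)‖²`. The whole derivative is twice the
    -- sum of two such real parts.
    have e4 : (inner ℂ (u' : L2C) (tripleProduct v v u)).re = 0 := by
      rw [← inner_proj, ← nonlin_eq, hu', inner_smul_left, inner_self_eq_norm_sq_to_K]
      simp [← Complex.ofReal_pow]
    have e5 : (inner ℂ (v' : L2C) (tripleProduct u u v)).re = 0 := by
      rw [← inner_proj, ← nonlin_eq, hv', inner_smul_left, inner_self_eq_norm_sq_to_K]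
      simp [← Complex.ofReal_pow]
    rw [e1, e2, e3]
    generalize inner ℂ (u' : L2C) (tripleProduct v v u) = A at e4
    generalize inner ℂ (v' : L2C) (tripleProduct u u v) = B at e5
    apply Complex.ext
    · simp [e4, e5]
    · simp
  have h2 := is_const_of_deriv_eq_zero (fun t => (h1 t).differentiableAt)
    (fun t => (h1 t).deriv) t 0
  exact_mod_cast h2

/-! ### Continuous representatives and the reproducing kernel -/

theorem enorm_sq_L2C (h : L2C) : ‖h‖ₑ ^ 2 = ∫⁻ z : ℂ, ‖h z‖ₑ ^ 2 := by
  have h4 := eLpNorm_nnreal_pow_eq_lintegral (p := 2) (f := (h : ℂ → ℂ))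
    (μ := (volume : Measure ℂ)) (by norm_num)
  rw [Lp.enorm_def]
  simpa only [NNReal.coe_ofNat, ENNReal.rpow_ofNat, ENNReal.coe_ofNat] using h4

theorem continuous_gaussMul {f : ℂ → ℂ} (hf : Differentiable ℂ f) : Continuous (gaussMul f) := by
  have := hf.continuous
  unfold gaussMul
  fun_prop

/-- The entire function `f` such that `u(z) = e^{-|z|²/2} f(z)`. -/
def holo (u : BargmannFock) : ℂ → ℂ := u.2.choose

theorem differentiable_holo (u : BargmannFock) : Differentiable ℂ (holo u) :=
  u.2.choose_spec.1

/-- The continuous representative of an element of the Bargmann-Fock space. -/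
def rep (u : BargmannFock) : ℂ → ℂ := gaussMul (holo u)

theorem toFun_ae_eq_rep (u : BargmannFock) : toFun u =ᵐ[volume] rep u :=
  u.2.choose_spec.2

theorem continuous_rep (u : BargmannFock) : Continuous (rep u) :=
  continuous_gaussMul (differentiable_holo u)

/-- Continuous functions equal almost everywhere coincide, so identities in `ℰ` can be checked
pointwise on representatives. -/
theorem rep_eq_of_ae_eq {u : BargmannFock} {g : ℂ → ℂ} (hg : Continuous g)
    (h : toFun u =ᵐ[volume] g) : rep u = g :=
  (Continuous.ae_eq_iff_eq volume (continuous_rep u) hg).1 ((toFun_ae_eq_rep u).symm.trans h)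

theorem rep_add (u v : BargmannFock) : rep (u + v) = rep u + rep v := by
  refine rep_eq_of_ae_eq ((continuous_rep u).add (continuous_rep v)) ?_
  filter_upwards [Lp.coeFn_add (u : L2C) (v : L2C), toFun_ae_eq_rep u, toFun_ae_eq_rep v]
    with z h h1 h2
  exact h.trans (congrArg₂ (· + ·) h1 h2)

theorem rep_smul (c : ℂ) (u : BargmannFock) : rep (c • u) = c • rep u := by
  refine rep_eq_of_ae_eq ((continuous_rep u).const_smul c) ?_
  filter_upwards [Lp.coeFn_smul c (u : L2C), toFun_ae_eq_rep u] with z h h1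
  exact h.trans (congrArg (c • ·) h1)

theorem exists_norm_rep_le : ∃ C : ℝ, 0 ≤ C ∧ ∀ u z, ‖rep u z‖ ≤ C * ‖u‖ := by
  obtain ⟨C, hC, hb⟩ := exists_norm_gaussMul_le
  exact ⟨C, hC, fun u z => hb u (holo u) (differentiable_holo u) (toFun_ae_eq_rep u) z⟩

theorem gaussMass_toReal_pos : 0 < gaussMass.toReal :=
  ENNReal.toReal_pos gaussMass_ne_zero gaussMass_ne_top

/-- The constant is sharp, with equality at the kernel centred at `ζ`; the reproducing property is
deduced from this extremality. -/
theorem gaussMass_mul_norm_rep_sq_le (u : BargmannFock) (ζ : ℂ) :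
    gaussMass.toReal * ‖rep u ζ‖ ^ 2 ≤ ‖u‖ ^ 2 := by
  have h1 := sq_gaussMul_le (differentiable_holo u) ζ
  have h2 : ∫⁻ w : ℂ, ‖gaussMul (holo u) w‖ₑ ^ 2 = ‖(u : L2C)‖ₑ ^ 2 := by
    rw [enorm_sq_L2C]
    refine lintegral_congr_ae ?_
    filter_upwards [toFun_ae_eq_rep u] with w hw
    change _ = ‖toFun u w‖ₑ ^ 2
    rw [hw, rep]
  rw [h2] at h1
  have h3 := ENNReal.toReal_mono (by finiteness) h1
  rw [mul_comm]
  simpa [ENNReal.toReal_mul, rep] using h3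

theorem norm_sub_sq_complex (z ζ : ℂ) :
    ‖z - ζ‖ ^ 2 = ‖z‖ ^ 2 - 2 * (z * conj ζ).re + ‖ζ‖ ^ 2 := by
  simp only [← Complex.normSq_eq_norm_sq, Complex.normSq_apply, Complex.mul_re,
    Complex.conj_re, Complex.conj_im, Complex.sub_re, Complex.sub_im]
  ring

/-- The entire function `z ↦ e^{z ζ̄ - |ζ|²/2}`. -/
def kernelHolo (ζ z : ℂ) : ℂ := Complex.exp (z * conj ζ - (‖ζ‖ : ℂ) ^ 2 / 2)

theorem differentiable_kernelHolo (ζ : ℂ) : Differentiable ℂ (kernelHolo ζ) := by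
  unfold kernelHolo
  fun_prop

/-- The reproducing kernel `z ↦ e^{z ζ̄ - |ζ|²/2 - |z|²/2}`, up to normalization. -/
def kernelFun (ζ : ℂ) : ℂ → ℂ := gaussMul (kernelHolo ζ)

theorem continuous_kernelFun (ζ : ℂ) : Continuous (kernelFun ζ) :=
  continuous_gaussMul (differentiable_kernelHolo ζ)

theorem norm_kernelFun (ζ z : ℂ) : ‖kernelFun ζ z‖ = Real.exp (-‖z - ζ‖ ^ 2 / 2) := by
  rw [kernelFun, gaussMul, kernelHolo, norm_mul, Complex.norm_real,
    Real.norm_of_nonneg (Real.exp_pos _).le, Complex.norm_exp, ← Real.exp_add, norm_sub_sq_complex]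
  congr 1
  rw [Complex.sub_re, show ((‖ζ‖ : ℂ) ^ 2 / 2) = ((‖ζ‖ ^ 2 / 2 : ℝ) : ℂ) by push_cast; ring,
    Complex.ofReal_re]
  ring

theorem kernelFun_self (ζ : ℂ) : kernelFun ζ ζ = 1 := by
  rw [kernelFun, gaussMul, kernelHolo, Complex.ofReal_exp, ← Complex.exp_add, Complex.mul_conj,
    Complex.normSq_eq_norm_sq, ← Complex.exp_zero]
  congr 1
  push_cast
  ring

theorem lintegral_enorm_kernelFun_sq (ζ : ℂ) : ∫⁻ z, ‖kernelFun ζ z‖ₑ ^ 2 = gaussMass := by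
  rw [gaussMass, ← lintegral_sub_right_eq_self (μ := (volume : Measure ℂ))
    (fun z => ENNReal.ofReal (Real.exp (-‖z‖ ^ 2))) ζ]
  refine lintegral_congr fun z => ?_
  rw [← ofReal_norm, norm_kernelFun, ← ENNReal.ofReal_pow (Real.exp_pos _).le, ← Real.exp_nat_mul]
  congr 2
  push_cast
  ring

theorem memLp_kernelFun (ζ : ℂ) : MemLp (kernelFun ζ) 2 (volume : Measure ℂ) := by
  refine ⟨(continuous_kernelFun ζ).aestronglyMeasurable, ?_⟩
  have h4 := eLpNorm_nnreal_pow_eq_lintegral (p := 2) (f := kernelFun ζ)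
    (μ := (volume : Measure ℂ)) (by norm_num)
  have h5 : eLpNorm (kernelFun ζ) 2 volume ^ 2 = gaussMass := by
    rw [← lintegral_enorm_kernelFun_sq ζ]
    simpa only [NNReal.coe_ofNat, ENNReal.rpow_ofNat, ENNReal.coe_ofNat] using h4
  have h6 : eLpNorm (kernelFun ζ) 2 volume ^ 2 < ⊤ := by
    rw [h5]
    exact gaussMass_ne_top.lt_top
  exact (ENNReal.pow_lt_top_iff.1 h6).resolve_right (by norm_num)

/-- The reproducing kernel as an element of the Bargmann-Fock space, up to normalization. -/
def kernel (ζ : ℂ) : BargmannFock :=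
  ⟨(memLp_kernelFun ζ).toLp, kernelHolo ζ, differentiable_kernelHolo ζ,
    (memLp_kernelFun ζ).coeFn_toLp⟩

theorem toFun_kernel (ζ : ℂ) : toFun (kernel ζ) =ᵐ[volume] kernelFun ζ :=
  (memLp_kernelFun ζ).coeFn_toLp

theorem rep_kernel (ζ : ℂ) : rep (kernel ζ) = kernelFun ζ :=
  rep_eq_of_ae_eq (continuous_kernelFun ζ) (toFun_kernel ζ)

theorem norm_kernel_sq (ζ : ℂ) : ‖kernel ζ‖ ^ 2 = gaussMass.toReal := by
  have h := enorm_sq_L2C (kernel ζ : L2C)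
  have h2 : ∫⁻ z : ℂ, ‖(kernel ζ : L2C) z‖ₑ ^ 2 = gaussMass := by
    rw [← lintegral_enorm_kernelFun_sq ζ]
    refine lintegral_congr_ae ?_
    filter_upwards [toFun_kernel ζ] with z hz
    rw [← hz]
    rfl
  rw [h2] at h
  rw [← h]
  simp

/-- The reproducing property. The form `u ↦ ‖u‖² - m |u(ζ)|²` is nonnegative and vanishes at the
kernel, so that the kernel lies in its radical. -/
theorem inner_kernel (ζ : ℂ) (u : BargmannFock) :
    inner ℂ (kernel ζ) u = gaussMass.toReal * rep u ζ := by
  set m := gaussMass.toReal with hm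
  set k := kernel ζ with hk
  set w : BargmannFock := u - rep u ζ • k with hw
  have hkk : inner ℂ k k = (m : ℂ) := by
    rw [inner_self_eq_norm_sq_to_K, hm, ← norm_kernel_sq ζ]
    norm_cast
  have hkζ : rep k ζ = 1 := by rw [hk, rep_kernel, kernelFun_self]
  have hw0 : rep w ζ = 0 := by
    have : w = u + (-rep u ζ) • k := by rw [hw, neg_smul, sub_eq_add_neg]
    rw [this, rep_add, rep_smul]
    simp [hkζ]
  have key : inner ℂ k w = 0 := by
    set c := inner ℂ k w with hc
    -- The pointwise bound is applied to `w - s c k`. The terms quadratic in `s` cancel since `‖k‖²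
    -- = m` and `k(ζ) = 1`; an inequality linear in `s` and valid for all `s` forces `c = 0`.
    have hineq : ∀ s : ℝ, 2 * s * ‖c‖ ^ 2 ≤ ‖w‖ ^ 2 := by
      intro s
      have h1 := gaussMass_mul_norm_rep_sq_le (w + (-(s * c) : ℂ) • k) ζ
      rw [rep_add, rep_smul, Pi.add_apply, hw0, Pi.smul_apply, hkζ, zero_add, smul_eq_mul, mul_one,
        norm_add_sq (𝕜 := ℂ), inner_smul_right, norm_smul, mul_pow, norm_kernel_sq,
        ← inner_conj_symm w k, ← hc] at h1
      have h2 : RCLike.re (-(s * c) * conj c) = -(s * ‖c‖ ^ 2) := by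
        rw [neg_mul, mul_assoc, Complex.mul_conj, Complex.normSq_eq_norm_sq, ← Complex.ofReal_mul,
          ← Complex.ofReal_neg]
        exact Complex.ofReal_re _
      rw [h2] at h1
      linarith
    by_contra hne
    have hpos : 0 < ‖c‖ ^ 2 := by positivity
    have h1 := hineq ((‖w‖ ^ 2 + 1) / ‖c‖ ^ 2)
    rw [mul_assoc, div_mul_cancel₀ _ hpos.ne'] at h1
    nlinarith [sq_nonneg ‖w‖]
  have hu : u = w + rep u ζ • k := by rw [hw, sub_add_cancel]
  conv_lhs => rw [hu]
  rw [inner_add_right, key, inner_smul_right, hkk]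
  ring

theorem rep_proj (h : L2C) (ζ : ℂ) :
    gaussMass.toReal * rep (proj h) ζ = ∫ z, conj (kernelFun ζ z) * h z := by
  rw [← inner_kernel, inner_proj, L2.inner_def]
  refine integral_congr_ae ?_
  filter_upwards [toFun_kernel ζ] with z hz
  rw [RCLike.inner_apply, mul_comm, ← hz]
  rfl

/-- Up to the factor `gaussMass`, the projection is dominated pointwise by convolution with a
Gaussian. -/
theorem enorm_rep_proj_le (h : L2C) (ζ : ℂ) :
    gaussMass * ‖rep (proj h) ζ‖ₑ ≤
      ∫⁻ z, ENNReal.ofReal (Real.exp (-‖ζ - z‖ ^ 2 / 2)) * ‖h z‖ₑ := by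
  have h1 : ‖(gaussMass.toReal : ℂ) * rep (proj h) ζ‖ₑ = gaussMass * ‖rep (proj h) ζ‖ₑ := by
    rw [enorm_mul, ← ofReal_norm, Complex.norm_real, Real.norm_of_nonneg gaussMass_toReal_pos.le,
      ENNReal.ofReal_toReal gaussMass_ne_top]
  rw [← h1, rep_proj]
  refine (enorm_integral_le_lintegral_enorm _).trans (le_of_eq (lintegral_congr fun z => ?_))
  rw [enorm_mul, ← ofReal_norm, RCLike.norm_conj, norm_kernelFun, norm_sub_rev]

/-! ### Young's inequality and boundedness of the projection in weighted spaces -/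

/-- Cauchy–Schwarz for the splitting `k g = k^{1/2} · (k^{1/2} g)`. -/
theorem sq_lintegral_mul_le {α : Type*} [MeasurableSpace α] (μ : Measure α) {k g : α → ENNReal}
    (hk : Measurable k) (hg : Measurable g) :
    (∫⁻ x, k x * g x ∂μ) ^ 2 ≤ (∫⁻ x, k x ∂μ) * ∫⁻ x, k x * g x ^ 2 ∂μ := by
  have h := ENNReal.lintegral_mul_le_Lp_mul_Lq μ Real.HolderConjugate.two_two
    (f := fun x => k x ^ (1 / 2 : ℝ)) (g := fun x => k x ^ (1 / 2 : ℝ) * g x)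
    (by fun_prop) (by fun_prop)
  have hs : ∀ a : ENNReal, (a ^ (1 / 2 : ℝ)) ^ (2 : ℝ) = a := fun a => by
    rw [← ENNReal.rpow_mul]
    norm_num
  have hs' : ∀ a : ENNReal, (a ^ (1 / 2 : ℝ)) ^ 2 = a := fun a => by
    rw [← ENNReal.rpow_two, hs]
  simp only [Pi.mul_apply, hs, ENNReal.mul_rpow_of_nonneg _ _ zero_le_two, ← mul_assoc,
    ← pow_two, hs', ENNReal.rpow_two] at h
  calc _ ≤ _ := pow_le_pow_left' h 2
    _ = _ := by rw [mul_pow, hs', hs']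

/-- Young's inequality `‖k ⋆ g‖₂ ≤ ‖k‖₁ ‖g‖₂` for nonnegative functions. -/
theorem lintegral_sq_convolution_le {k g : ℂ → ENNReal} (hk : Measurable k) (hg : Measurable g) :
    ∫⁻ z, (∫⁻ y, k (z - y) * g y) ^ 2 ≤ (∫⁻ z, k z) ^ 2 * ∫⁻ y, g y ^ 2 := by
  have h1 : ∀ z, (∫⁻ y, k (z - y) * g y) ^ 2 ≤ (∫⁻ x, k x) * ∫⁻ y, k (z - y) * g y ^ 2 :=
    fun z => by
      refine (sq_lintegral_mul_le volume (k := fun y => k (z - y)) (by fun_prop) hg).trans ?_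
      rw [lintegral_sub_left_eq_self]
  calc _ ≤ ∫⁻ z, (∫⁻ x, k x) * ∫⁻ y, k (z - y) * g y ^ 2 := lintegral_mono h1
    _ = (∫⁻ x, k x) * ∫⁻ z, ∫⁻ y, k (z - y) * g y ^ 2 := by
        refine lintegral_const_mul _ (Measurable.lintegral_prod_right' (f := fun p : ℂ × ℂ =>
          k (p.1 - p.2) * g p.2 ^ 2) (by fun_prop))
    _ = (∫⁻ x, k x) * ∫⁻ y, ∫⁻ z, k (z - y) * g y ^ 2 := by
        rw [lintegral_lintegral_swap]
        exact (by fun_prop : Measurable fun p : ℂ × ℂ => k (p.1 - p.2) * g p.2 ^ 2).aemeasurable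
    _ = (∫⁻ x, k x) * ∫⁻ y, (∫⁻ x, k x) * g y ^ 2 := by
        congr 2 with y
        rw [lintegral_mul_const _ (by fun_prop), lintegral_sub_right_eq_self]
    _ = _ := by
        rw [lintegral_const_mul _ (by fun_prop), ← mul_assoc, ← pow_two]

/-- The weight `⟨z⟩^s`. -/
def weight (s : ℝ) (z : ℂ) : ℝ := Real.sqrt (1 + ‖z‖ ^ 2) ^ s

theorem weight_nonneg (s : ℝ) (z : ℂ) : 0 ≤ weight s z := by unfold weight; positivity

theorem continuous_weight (s : ℝ) : Continuous (weight s) := by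
  unfold weight
  refine Continuous.rpow_const (by fun_prop) fun z => Or.inl ?_
  positivity

theorem one_add_sq_le (z y : ℂ) :
    1 + ‖z‖ ^ 2 ≤ 2 * (1 + ‖y‖ ^ 2) * (1 + ‖z - y‖ ^ 2) := by
  have h1 : ‖z‖ ≤ ‖z - y‖ + ‖y‖ := by simpa using norm_add_le (z - y) y
  have h2 : ‖z‖ ^ 2 ≤ (‖z - y‖ + ‖y‖) ^ 2 := by gcongr
  nlinarith [sq_nonneg (‖z - y‖ - ‖y‖), mul_nonneg (sq_nonneg ‖z - y‖) (sq_nonneg ‖y‖)]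

/-- Peetre's inequality, with the polynomial in `z - y` absorbed by a Gaussian factor. The exponent
`1/4` is below the `1/2` of the kernel, so an integrable Gaussian remains; `1 ≤ C` lets the bound
pass to truncated weights. -/
theorem exists_weight_le {s : ℝ} (hs : 0 < s) :
    ∃ C : ℝ, 1 ≤ C ∧ ∀ z y, weight s z ≤ C * Real.exp (‖z - y‖ ^ 2 / 4) * weight s y := by
  -- Chosen so that `1 + x ≤ A e^{x/(2s)}` for `x ≥ 0`; the power `s/2` turns the exponential into
  -- `e^{x/4}`.
  set A : ℝ := max 1 (2 * s) with hA
  have hA1 : 1 ≤ A := le_max_left _ _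
  have hs2 : 0 ≤ s / 2 := by positivity
  refine ⟨(2 * A) ^ (s / 2), Real.one_le_rpow (by linarith) hs2, fun z y => ?_⟩
  have hw : ∀ z, weight s z = (1 + ‖z‖ ^ 2) ^ (s / 2) := fun z => by
    rw [weight, Real.sqrt_eq_rpow, ← Real.rpow_mul (by positivity)]
    congr 1
    ring
  have h1 : 1 + ‖z - y‖ ^ 2 ≤ A * Real.exp (‖z - y‖ ^ 2 / (2 * s)) := by
    have h2 := Real.add_one_le_exp (‖z - y‖ ^ 2 / (2 * s))
    calc 1 + ‖z - y‖ ^ 2 = 1 + 2 * s * (‖z - y‖ ^ 2 / (2 * s)) := by field_simp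
      _ ≤ A + A * (‖z - y‖ ^ 2 / (2 * s)) := by
          gcongr
          exact le_max_right _ _
      _ = A * (‖z - y‖ ^ 2 / (2 * s) + 1) := by ring
      _ ≤ _ := by gcongr
  rw [hw, hw]
  calc (1 + ‖z‖ ^ 2) ^ (s / 2)
      ≤ (2 * (1 + ‖y‖ ^ 2) * (A * Real.exp (‖z - y‖ ^ 2 / (2 * s)))) ^ (s / 2) := by
        refine Real.rpow_le_rpow (by positivity) ((one_add_sq_le z y).trans ?_) hs2
        gcongr
    _ = ((2 * A) * Real.exp (‖z - y‖ ^ 2 / (2 * s)) * (1 + ‖y‖ ^ 2)) ^ (s / 2) := by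
        congr 1
        ring
    _ = _ := by
        rw [Real.mul_rpow (by positivity) (by positivity),
          Real.mul_rpow (by positivity) (by positivity), ← Real.exp_mul]
        congr 3
        field_simp
        norm_num

/-- The bounded weight `min(⟨z⟩^s, n)`. -/
def truncWeight (s : ℝ) (n : ℕ) (z : ℂ) : ℝ := min (weight s z) n

theorem truncWeight_nonneg (s : ℝ) (n : ℕ) (z : ℂ) : 0 ≤ truncWeight s n z :=
  le_min (weight_nonneg s z) n.cast_nonneg

theorem continuous_truncWeight (s : ℝ) (n : ℕ) : Continuous (truncWeight s n) :=
  (continuous_weight s).min continuous_const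

theorem memLp_truncWeight (s : ℝ) (n : ℕ) :
    MemLp (fun z => (truncWeight s n z : ℂ)) ⊤ (volume : Measure ℂ) := by
  refine memLp_top_of_bound
    (Complex.continuous_ofReal.comp (continuous_truncWeight s n)).aestronglyMeasurable n
    (Eventually.of_forall fun z => ?_)
  rw [Complex.norm_real, Real.norm_of_nonneg (truncWeight_nonneg s n z)]
  exact min_le_right _ _

/-- Multiplication by the weight `min(⟨z⟩^s, n)` on `L²`. -/
def weightMul (s : ℝ) (n : ℕ) : L2C →L[ℝ] L2C :=
  (ContinuousLinearMap.mul ℝ ℂ).holderL volume ⊤ 2 2 (memLp_truncWeight s n).toLp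

theorem coeFn_weightMul (s : ℝ) (n : ℕ) (h : L2C) :
    weightMul s n h =ᵐ[volume] fun z => (truncWeight s n z : ℂ) * h z := by
  have h1 := (ContinuousLinearMap.mul ℝ ℂ).coeFn_holder (r := 2) (memLp_truncWeight s n).toLp h
  filter_upwards [h1, (memLp_truncWeight s n).coeFn_toLp] with z h1 h2
  refine h1.trans ?_
  rw [h2]
  rfl

theorem weightMul_smul (s : ℝ) (n : ℕ) (c : ℂ) (h : L2C) :
    weightMul s n (c • h) = c • weightMul s n h := by
  refine Lp.ext ?_
  filter_upwards [coeFn_weightMul s n (c • h), coeFn_weightMul s n h,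
    Lp.coeFn_smul c h, Lp.coeFn_smul c (weightMul s n h)] with z h1 h2 h3 h4
  rw [h1, h4, h3, Pi.smul_apply, Pi.smul_apply, h2, smul_eq_mul, smul_eq_mul]
  ring

theorem lintegral_exp_neg_lt_top : ∫⁻ z : ℂ, ENNReal.ofReal (Real.exp (-‖z‖ ^ 2 / 4)) < ⊤ := by
  have h := GaussianFourier.integrable_cexp_neg_mul_sq_norm_add (V := ℂ) (b := (1 / 4 : ℝ))
    (by rw [Complex.ofReal_re]; norm_num) 0 0
  have h3 := h.norm
  refine Integrable.lintegral_lt_top (h3.congr (Eventually.of_forall fun z => ?_))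
  simp only [Complex.norm_exp]
  congr 1
  have : (-((1 / 4 : ℝ) : ℂ) * (‖z‖ : ℂ) ^ 2 + 0 * (inner ℝ (0 : ℂ) z : ℂ)) =
      ((-‖z‖ ^ 2 / 4 : ℝ) : ℂ) := by
    push_cast
    ring
  rw [this, Complex.ofReal_re]

/-- The projection is bounded in weighted spaces, uniformly in the truncation of the weight. -/
theorem exists_norm_weightMul_proj_le {s : ℝ} (hs : 0 < s) :
    ∃ C : ℝ, 0 ≤ C ∧ ∀ n h, ‖weightMul s n (proj h : L2C)‖ ≤ C * ‖weightMul s n h‖ := by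
  obtain ⟨C, hC1, hC⟩ := exists_weight_le hs
  set k : ℂ → ENNReal := fun x => ENNReal.ofReal (C * Real.exp (-‖x‖ ^ 2 / 4)) with hk
  have hkm : Measurable k := by fun_prop
  have hkt : ∫⁻ z, k z ≠ ⊤ := by
    simp only [hk, ENNReal.ofReal_mul (by linarith : (0 : ℝ) ≤ C)]
    rw [lintegral_const_mul _ (by fun_prop)]
    exact ENNReal.mul_ne_top ENNReal.ofReal_ne_top lintegral_exp_neg_lt_top.ne
  have hw : ∀ n z y, truncWeight s n z ≤
      C * Real.exp (‖z - y‖ ^ 2 / 4) * truncWeight s n y := by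
    intro n z y
    have h1 : 1 ≤ C * Real.exp (‖z - y‖ ^ 2 / 4) :=
      one_le_mul_of_one_le_of_one_le hC1 (Real.one_le_exp (by positivity))
    rw [truncWeight, truncWeight, mul_min_of_nonneg _ _ (by linarith)]
    exact min_le_min (hC z y) (le_mul_of_one_le_left n.cast_nonneg h1)
  refine ⟨(∫⁻ z, k z).toReal / gaussMass.toReal, by positivity, fun n h => ?_⟩
  set g : ℂ → ENNReal := fun y => ‖(truncWeight s n y : ℂ) * h y‖ₑ with hg
  have hgm : Measurable g := by
    have h1 := (Lp.stronglyMeasurable h).measurable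
    have h2 := (Complex.continuous_ofReal.comp (continuous_truncWeight s n)).measurable
    exact (h2.mul h1).enorm
  -- Moving the weight from `z` to `y` costs `e^{|z-y|²/4}`, so `e^{-|z-y|²/2}` becomes
  -- `e^{-|z-y|²/4}`, and Young's inequality applies.
  have hpt : ∀ z, gaussMass * ‖(truncWeight s n z : ℂ) * rep (proj h) z‖ₑ ≤
      ∫⁻ y, k (z - y) * g y := by
    intro z
    rw [enorm_mul, mul_left_comm]
    refine (mul_le_mul_right (enorm_rep_proj_le h z) _).trans ?_
    rw [← lintegral_const_mul' _ _ enorm_ne_top]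
    refine lintegral_mono fun y => ?_
    rw [hg, hk]
    simp only
    rw [enorm_mul, ← mul_assoc, ← mul_assoc]
    refine mul_le_mul' ?_ le_rfl
    rw [← ofReal_norm, ← ofReal_norm, ← ENNReal.ofReal_mul (norm_nonneg _),
      ← ENNReal.ofReal_mul (by positivity), Complex.norm_real, Complex.norm_real,
      Real.norm_of_nonneg (truncWeight_nonneg _ _ _),
      Real.norm_of_nonneg (truncWeight_nonneg _ _ _)]
    refine ENNReal.ofReal_le_ofReal ?_
    calc _ ≤ C * Real.exp (‖z - y‖ ^ 2 / 4) * truncWeight s n y *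
          Real.exp (-‖z - y‖ ^ 2 / 2) := by gcongr; exact hw n z y
      _ = C * (Real.exp (‖z - y‖ ^ 2 / 4) * Real.exp (-‖z - y‖ ^ 2 / 2)) * truncWeight s n y := by
          ring
      _ = _ := by
          rw [← Real.exp_add]
          congr 3
          ring
  have hsq : (gaussMass * ‖weightMul s n (proj h : L2C)‖ₑ) ^ 2 ≤
      ((∫⁻ z, k z) * ‖weightMul s n h‖ₑ) ^ 2 := by
    rw [mul_pow, mul_pow, enorm_sq_L2C, enorm_sq_L2C,
      ← lintegral_const_mul' _ _ (by simp [gaussMass_ne_top])]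
    calc _ = ∫⁻ z, (gaussMass * ‖(truncWeight s n z : ℂ) * rep (proj h) z‖ₑ) ^ 2 := by
          refine lintegral_congr_ae ?_
          filter_upwards [coeFn_weightMul s n (proj h : L2C), toFun_ae_eq_rep (proj h)]
            with z h1 h2
          rw [h1, ← h2, mul_pow]
          rfl
      _ ≤ ∫⁻ z, (∫⁻ y, k (z - y) * g y) ^ 2 := lintegral_mono fun z => pow_le_pow_left' (hpt z) 2
      _ ≤ (∫⁻ z, k z) ^ 2 * ∫⁻ y, g y ^ 2 := lintegral_sq_convolution_le hkm hgm
      _ = _ := by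
          congr 1
          refine lintegral_congr_ae ?_
          filter_upwards [coeFn_weightMul s n h] with z h1
          rw [h1]
  have h1 := (ENNReal.pow_le_pow_left_iff two_ne_zero).1 hsq
  have h2 := ENNReal.toReal_mono (ENNReal.mul_ne_top hkt enorm_ne_top) h1
  rw [ENNReal.toReal_mul, ENNReal.toReal_mul, toReal_enorm, toReal_enorm] at h2
  rw [div_mul_eq_mul_div, le_div_iff₀ gaussMass_toReal_pos]
  linarith

/-- The trilinear map `(a, b, c) ↦ Π(a b̄ c)` is bounded in weighted spaces, linearly in the
weighted norm of one factor. -/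
theorem exists_norm_weightMul_tripleProduct_le {s : ℝ} (hs : 0 < s) :
    ∃ D : ℝ, 0 ≤ D ∧ ∀ n a b c, ‖weightMul s n (proj (tripleProduct a b c) : L2C)‖ ≤
      D * ‖a‖ * ‖b‖ * ‖weightMul s n (c : L2C)‖ := by
  obtain ⟨C, hC, hC'⟩ := exists_norm_weightMul_proj_le hs
  obtain ⟨A, hA, hA'⟩ := exists_norm_rep_le
  refine ⟨C * A ^ 2, by positivity, fun n a b c => (hC' n _).trans ?_⟩
  have h1 : ‖weightMul s n (tripleProduct a b c)‖ ≤
      (A * ‖a‖) * (A * ‖b‖) * ‖weightMul s n (c : L2C)‖ := by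
    refine Lp.norm_le_mul_norm_of_ae_le_mul ?_
    filter_upwards [coeFn_weightMul s n (tripleProduct a b c), coeFn_weightMul s n (c : L2C),
      coeFn_tripleProduct a b c, toFun_ae_eq_rep a, toFun_ae_eq_rep b] with z h1 h2 h3 h4 h5
    rw [h1, h2, h3, h4, h5, norm_mul, norm_mul, norm_mul, norm_mul, RCLike.norm_conj]
    calc _ = ‖rep a z‖ * ‖rep b z‖ * (‖(truncWeight s n z : ℂ)‖ * ‖toFun c z‖) := by ring
      _ ≤ _ := by
        gcongr
        · exact hA' a z
        · exact hA' b z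
        · rfl
  calc _ ≤ C * ((A * ‖a‖) * (A * ‖b‖) * ‖weightMul s n (c : L2C)‖) := by gcongr
    _ = _ := by ring

/-- Fatou's lemma: at each point the truncated weights are eventually equal to the full one. -/
theorem weightedL2_of_norm_weightMul_le {s M : ℝ} {u : BargmannFock}
    (h : ∀ n, ‖weightMul s n (u : L2C)‖ ≤ M) :
    WeightedL2 s u ∧ ∫⁻ z, ‖(weight s z : ℂ) * toFun u z‖ₑ ^ 2 ≤ ENNReal.ofReal M ^ 2 := by
  have hm : Measurable (toFun u) := (Lp.stronglyMeasurable (u : L2C)).measurable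
  have hw := fun n => (Complex.continuous_ofReal.comp (continuous_truncWeight s n)).measurable
  have hlim : ∀ z, Tendsto (fun n : ℕ => ‖(truncWeight s n z : ℂ) * toFun u z‖ₑ ^ 2) atTop
      (𝓝 (‖(weight s z : ℂ) * toFun u z‖ₑ ^ 2)) := by
    intro z
    refine tendsto_const_nhds.congr' ?_
    obtain ⟨N, hN⟩ := exists_nat_ge (weight s z)
    filter_upwards [eventually_ge_atTop N] with n hn
    rw [truncWeight, min_eq_left (hN.trans (by exact_mod_cast hn))]
  have hle : ∫⁻ z, ‖(weight s z : ℂ) * toFun u z‖ₑ ^ 2 ≤ ENNReal.ofReal M ^ 2 := by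
    calc _ = ∫⁻ z, liminf (fun n : ℕ => ‖(truncWeight s n z : ℂ) * toFun u z‖ₑ ^ 2) atTop :=
          lintegral_congr fun z => (hlim z).liminf_eq.symm
      _ ≤ liminf (fun n : ℕ => ∫⁻ z, ‖(truncWeight s n z : ℂ) * toFun u z‖ₑ ^ 2) atTop :=
          lintegral_liminf_le fun n => (((hw n).mul hm).enorm.pow_const 2)
      _ ≤ _ := by
          refine liminf_le_of_frequently_le' (Frequently.of_forall fun n => ?_)
          have h1 : ∫⁻ z, ‖(truncWeight s n z : ℂ) * toFun u z‖ₑ ^ 2 =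
              ‖weightMul s n (u : L2C)‖ₑ ^ 2 := by
            rw [enorm_sq_L2C]
            refine lintegral_congr_ae ?_
            filter_upwards [coeFn_weightMul s n (u : L2C)] with z h1
            rw [h1]
            rfl
          rw [h1, ← ofReal_norm]
          gcongr
          exact h n
  refine ⟨⟨?_, ?_⟩, hle⟩
  · exact ((Complex.continuous_ofReal.comp (continuous_weight s)).measurable.mul
      hm).aestronglyMeasurable
  · have h4 := eLpNorm_nnreal_pow_eq_lintegral (p := 2)
      (f := fun z => (weight s z : ℂ) * toFun u z) (μ := (volume : Measure ℂ)) (by norm_num)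
    have h6 : eLpNorm (fun z => (weight s z : ℂ) * toFun u z) 2 volume ^ 2 < ⊤ := by
      simp only [NNReal.coe_ofNat, ENNReal.rpow_ofNat, ENNReal.coe_ofNat] at h4
      rw [h4]
      exact hle.trans_lt (by finiteness)
    exact (ENNReal.pow_lt_top_iff.1 h6).resolve_right (by norm_num)

theorem exists_norm_weightMul_le {s : ℝ} {u : BargmannFock} (h : WeightedL2 s u) :
    ∃ M : ℝ, ∀ n, ‖weightMul s n (u : L2C)‖ ≤ M := by
  refine ⟨‖MemLp.toLp _ h‖, fun n => Lp.norm_le_norm_of_ae_le ?_⟩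
  filter_upwards [coeFn_weightMul s n (u : L2C), MemLp.coeFn_toLp h] with z h1 h2
  rw [h1, h2, norm_mul, norm_mul, Complex.norm_real, Complex.norm_real,
    Real.norm_of_nonneg (truncWeight_nonneg _ _ _),
    Real.norm_of_nonneg (show 0 ≤ Real.sqrt (1 + ‖z‖ ^ 2) ^ s from weight_nonneg s z)]
  exact mul_le_mul_of_nonneg_right (min_le_left _ _) (norm_nonneg _)

/-! ### Propagation of weighted norms along solutions -/

theorem norm_le_mul_exp_of_hasDerivAt {E : Type*} [NormedAddCommGroup E] [NormedSpace ℝ E]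
    {y y' : ℝ → E} {K : ℝ} (hy : ∀ t, HasDerivAt y (y' t) t) (hK : ∀ t, ‖y' t‖ ≤ K * ‖y t‖)
    (t : ℝ) : ‖y t‖ ≤ ‖y 0‖ * Real.exp (K * |t|) := by
  have key : ∀ (y y' : ℝ → E), (∀ t, HasDerivAt y (y' t) t) → (∀ t, ‖y' t‖ ≤ K * ‖y t‖) →
      ∀ t, 0 ≤ t → ‖y t‖ ≤ ‖y 0‖ * Real.exp (K * t) := by
    intro y y' hy hK t ht
    have h := norm_le_gronwallBound_of_norm_deriv_right_le (f := y) (f' := y') (δ := ‖y 0‖) (K := K)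
      (ε := 0) (a := 0) (b := t) (HasDerivAt.continuousOn fun s _ => hy s)
      (fun s _ => (hy s).hasDerivWithinAt) le_rfl (fun s _ => by simpa using hK s) t ⟨ht, le_rfl⟩
    rwa [gronwallBound_ε0, sub_zero] at h
  rcases le_total 0 t with ht | ht
  · rw [abs_of_nonneg ht]
    exact key y y' hy hK t ht
  · rw [abs_of_nonpos ht]
    -- Negative times follow from Grönwall's inequality for the time-reversed curve.
    have h := key (fun s => y (-s)) (fun s => -y' (-s)) (fun s => by
      simpa [Function.comp_def] using (hy (-s)).scomp s (hasDerivAt_neg s))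
      (fun s => by simpa using hK (-s)) (-t) (by linarith)
    simpa using h

/-- `(u, v)` is a solution of `∂ₜ u = c Π(|v|² u)`, `∂ₜ v = d Π(|u|² v)`, bounded by `B`. -/
structure IsCoupledSolution (c d : ℂ) (B : ℝ) (u v : ℝ → BargmannFock) : Prop where
  hasDerivAt_left : ∀ t, HasDerivAt u (c • nonlin (v t) (u t)) t
  hasDerivAt_right : ∀ t, HasDerivAt v (d • nonlin (u t) (v t)) t
  norm_left_le : ∀ t, ‖u t‖ ≤ B
  norm_right_le : ∀ t, ‖v t‖ ≤ B

namespace IsCoupledSolution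

variable {c d : ℂ} {B : ℝ} {u v : ℝ → BargmannFock}

theorem symm (h : IsCoupledSolution c d B u v) : IsCoupledSolution d c B v u :=
  ⟨h.hasDerivAt_right, h.hasDerivAt_left, h.norm_right_le, h.norm_left_le⟩

theorem nonneg (h : IsCoupledSolution c d B u v) : 0 ≤ B :=
  (norm_nonneg _).trans (h.norm_left_le 0)

theorem hasDerivAt_weightMul (h : IsCoupledSolution c d B u v) (s : ℝ) (n : ℕ) (t : ℝ) :
    HasDerivAt (fun r => weightMul s n (u r : L2C))
      (c • weightMul s n (nonlin (v t) (u t) : L2C)) t := by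
  have h1 : HasDerivAt (fun r => (u r : L2C)) ((c • nonlin (v t) (u t) : BargmannFock) : L2C) t :=
    (BargmannFock.subtypeL.restrictScalars ℝ).hasFDerivAt.comp_hasDerivAt t (h.hasDerivAt_left t)
  have h2 := (weightMul s n).hasFDerivAt.comp_hasDerivAt t h1
  rw [Submodule.coe_smul, weightMul_smul] at h2
  exact h2

/-- Truncated weighted norms grow at most exponentially, uniformly in the truncation. -/
theorem exists_norm_weightMul_le_mul_exp (h : IsCoupledSolution c d B u v) {s : ℝ} (hs : 0 < s) :
    ∃ K : ℝ, ∀ n t, ‖weightMul s n (u t : L2C)‖ ≤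
      ‖weightMul s n (u 0 : L2C)‖ * Real.exp (K * |t|) := by
  obtain ⟨D, hD, hD'⟩ := exists_norm_weightMul_tripleProduct_le hs
  have hB := h.nonneg
  -- The weight is carried by `u` alone and the two factors `v` cost `B` each, so no weighted
  -- information on `v` is needed.
  refine ⟨‖c‖ * (D * B * B), fun n t => ?_⟩
  refine norm_le_mul_exp_of_hasDerivAt (fun t => h.hasDerivAt_weightMul s n t) (fun t => ?_) t
  rw [norm_smul, nonlin_eq, mul_assoc]
  gcongr
  refine (hD' n _ _ _).trans ?_
  gcongr
  · exact h.norm_right_le t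
  · exact h.norm_right_le t

theorem exists_norm_weightMul_le_of_abs_le (h : IsCoupledSolution c d B u v) {s : ℝ} (hs : 0 < s)
    (h0 : WeightedL2 s (u 0)) (T : ℝ) :
    ∃ M : ℝ, 0 ≤ M ∧ ∀ n t, |t| ≤ T → ‖weightMul s n (u t : L2C)‖ ≤ M := by
  obtain ⟨K, hK⟩ := h.exists_norm_weightMul_le_mul_exp hs
  obtain ⟨M, hM⟩ := exists_norm_weightMul_le h0
  have hM0 : 0 ≤ M := (norm_nonneg _).trans (hM 0)
  refine ⟨M * Real.exp (|K| * T), by positivity, fun n t ht => (hK n t).trans ?_⟩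
  gcongr
  · exact hM n
  · exact le_abs_self K

/-- Weighted spaces are preserved by the flow. -/
theorem weightedL2 (h : IsCoupledSolution c d B u v) {s : ℝ} (hs : 0 < s)
    (h0 : WeightedL2 s (u 0)) (t : ℝ) : WeightedL2 s (u t) := by
  obtain ⟨M, -, hM⟩ := h.exists_norm_weightMul_le_of_abs_le hs h0 |t|
  exact (weightedL2_of_norm_weightMul_le fun n => hM n t le_rfl).1

theorem weightedL2_deriv (h : IsCoupledSolution c d B u v) {s : ℝ} (hs : 0 < s)
    (h0 : WeightedL2 s (u 0)) (t : ℝ) : WeightedL2 s (c • nonlin (v t) (u t)) := by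
  obtain ⟨M, -, hM⟩ := h.exists_norm_weightMul_le_of_abs_le hs h0 |t|
  obtain ⟨D, hD, hD'⟩ := exists_norm_weightMul_tripleProduct_le hs
  refine (weightedL2_of_norm_weightMul_le (M := ‖c‖ * (D * ‖v t‖ * ‖v t‖ * M)) fun n => ?_).1
  rw [Submodule.coe_smul, weightMul_smul, norm_smul, nonlin_eq]
  gcongr
  refine (hD' n _ _ _).trans ?_
  gcongr
  exact hM n t le_rfl

theorem exists_norm_sub_le (h : IsCoupledSolution c d B u v) :
    ∃ L : ℝ, 0 ≤ L ∧ ∀ r t, ‖u r - u t‖ ≤ L * |r - t| := by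
  have hB := h.nonneg
  set P := (ContinuousLinearMap.restrictScalars ℝ proj : L2C →L[ℝ] BargmannFock)
  refine ⟨‖c‖ * (‖P‖ * (‖tripleProduct‖ * B * B * B)), by positivity, fun r t => ?_⟩
  have hd : ∀ x ∈ (Set.univ : Set ℝ), HasDerivWithinAt u (c • nonlin (v x) (u x)) Set.univ x :=
    fun x _ => (h.hasDerivAt_left x).hasDerivWithinAt
  refine convex_univ.norm_image_sub_le_of_norm_hasDerivWithin_le hd (fun x _ => ?_)
    (Set.mem_univ t) (Set.mem_univ r)
  rw [norm_smul, nonlin_eq]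
  gcongr
  refine (P.le_opNorm _).trans ?_
  gcongr
  refine ((tripleProduct (v x)).le_opNorm₂ _ _).trans ?_
  have := h.norm_left_le x
  have := h.norm_right_le x
  calc _ ≤ ‖tripleProduct‖ * ‖v x‖ * ‖v x‖ * ‖u x‖ := by
        gcongr
        exact tripleProduct.le_opNorm _
    _ ≤ _ := by gcongr

/-- A Lipschitz bound in time uniform in the truncation; it controls the increment of `u` in the
derivative below, which makes the Taylor remainder quadratic. -/
theorem exists_norm_weightMul_sub_le (h : IsCoupledSolution c d B u v) {s : ℝ} (hs : 0 < s)
    (h0 : WeightedL2 s (u 0)) (T : ℝ) :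
    ∃ L : ℝ, 0 ≤ L ∧ ∀ n r t, |r| ≤ T → |t| ≤ T →
      ‖weightMul s n (u r : L2C) - weightMul s n (u t : L2C)‖ ≤ L * |r - t| := by
  obtain ⟨M, hM0, hM⟩ := h.exists_norm_weightMul_le_of_abs_le hs h0 T
  obtain ⟨D, hD, hD'⟩ := exists_norm_weightMul_tripleProduct_le hs
  have hB := h.nonneg
  refine ⟨‖c‖ * (D * B * B * M), by positivity, fun n r t hr ht => ?_⟩
  have hd : ∀ x ∈ Set.Icc (-T) T, HasDerivWithinAt (fun r => weightMul s n (u r : L2C))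
      (c • weightMul s n (nonlin (v x) (u x) : L2C)) (Set.Icc (-T) T) x :=
    fun x _ => (h.hasDerivAt_weightMul s n x).hasDerivWithinAt
  refine (convex_Icc (-T) T).norm_image_sub_le_of_norm_hasDerivWithin_le hd (fun x hx => ?_)
    (abs_le.1 ht) (abs_le.1 hr)
  rw [norm_smul, nonlin_eq]
  gcongr
  refine (hD' n _ _ _).trans ?_
  gcongr
  · exact h.norm_right_le x
  · exact h.norm_right_le x
  · exact hM n x (abs_le.2 hx)

theorem nonlin_sub_nonlin (a b x y : BargmannFock) : nonlin b y - nonlin a x =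
    proj (tripleProduct (b - a) b y) + proj (tripleProduct a (b - a) y) +
      proj (tripleProduct a a (y - x)) := by
  simp only [nonlin_eq, map_sub, sub_apply]
  abel

/-- The solution is differentiable in weighted spaces, with a quadratic remainder. -/
theorem exists_norm_weightMul_remainder_le (h : IsCoupledSolution c d B u v) {s : ℝ} (hs : 0 < s)
    (h0 : WeightedL2 s (u 0)) (T : ℝ) :
    ∃ L : ℝ, 0 ≤ L ∧ ∀ n r t, |r| ≤ T → |t| ≤ T →
      ‖weightMul s n ((u r - u t - (r - t) • (c • nonlin (v t) (u t)) : BargmannFock) : L2C)‖ ≤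
        L * |r - t| ^ 2 := by
  obtain ⟨M, hM0, hM⟩ := h.exists_norm_weightMul_le_of_abs_le hs h0 T
  obtain ⟨M₁, hM₁0, hM₁⟩ := h.exists_norm_weightMul_sub_le hs h0 T
  obtain ⟨L₀, hL₀0, hL₀⟩ := h.symm.exists_norm_sub_le
  obtain ⟨D, hD, hD'⟩ := exists_norm_weightMul_tripleProduct_le hs
  have hB := h.nonneg
  set L := ‖c‖ * (D * L₀ * B * M + D * B * L₀ * M + D * B * B * M₁) with hL
  have hL0 : 0 ≤ L := by positivity
  refine ⟨L, hL0, fun n r t hr ht => ?_⟩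
  have hdiff : ∀ x, |x| ≤ T → ‖c • weightMul s n (nonlin (v x) (u x) : L2C) -
      c • weightMul s n (nonlin (v t) (u t) : L2C)‖ ≤ L * |x - t| := by
    intro x hx
    rw [← smul_sub, norm_smul, ← map_sub, ← Submodule.coe_sub, nonlin_sub_nonlin, hL, mul_assoc]
    gcongr
    rw [Submodule.coe_add, Submodule.coe_add, map_add, map_add]
    refine norm_add₃_le.trans ?_
    have hv := hL₀ x t
    have hvx := h.norm_right_le x
    have hvt := h.norm_right_le t
    have hu := hM₁ n x t hx ht
    have hux := hM n x hx
    rw [← map_sub, ← Submodule.coe_sub] at hu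
    calc _ ≤ D * ‖v x - v t‖ * ‖v x‖ * ‖weightMul s n (u x : L2C)‖ +
          D * ‖v t‖ * ‖v x - v t‖ * ‖weightMul s n (u x : L2C)‖ +
          D * ‖v t‖ * ‖v t‖ * ‖weightMul s n ((u x - u t : BargmannFock) : L2C)‖ :=
          add_le_add (add_le_add (hD' n _ _ _) (hD' n _ _ _)) (hD' n _ _ _)
      _ ≤ D * (L₀ * |x - t|) * B * M + D * B * (L₀ * |x - t|) * M +
          D * B * B * (M₁ * |x - t|) := by gcongr
      _ = _ := by ring
  -- The mean value inequality is applied to the solution minus its linearization at `t`, whose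
  -- derivative at `x` is at most `L |x - t|` by `hdiff`.
  have hd : ∀ x ∈ Set.uIcc t r, HasDerivWithinAt
      (fun r => weightMul s n (u r : L2C) - (r - t) • c • weightMul s n (nonlin (v t) (u t) : L2C))
      (c • weightMul s n (nonlin (v x) (u x) : L2C) -
        (1 : ℝ) • c • weightMul s n (nonlin (v t) (u t) : L2C)) (Set.uIcc t r) x :=
    fun x _ => ((h.hasDerivAt_weightMul s n x).sub
      (((hasDerivAt_id x).sub_const t).smul_const _)).hasDerivWithinAt
  have hmv := (convex_uIcc t r).norm_image_sub_le_of_norm_hasDerivWithin_le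
    (C := L * |r - t|) hd (fun x hx => ?_) Set.left_mem_uIcc Set.right_mem_uIcc
  · rw [pow_two, ← mul_assoc]
    refine le_trans (le_of_eq ?_) hmv
    congr 1
    have e : ((((r - t) • (c • nonlin (v t) (u t)) : BargmannFock)) : L2C) =
        (r - t) • c • (nonlin (v t) (u t) : L2C) := rfl
    rw [Submodule.coe_sub, Submodule.coe_sub, map_sub, map_sub, e, map_smul, weightMul_smul,
      sub_self, zero_smul, sub_zero]
    abel
  · rw [one_smul]
    have h1 : |x - t| ≤ |r - t| := by
      rcases Set.mem_uIcc.1 hx with h | h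
      · rw [abs_of_nonneg (by linarith), abs_of_nonneg (by linarith)]
        linarith
      · rw [abs_of_nonpos (by linarith), abs_of_nonpos (by linarith)]
        linarith
    have h2 : |x| ≤ T := by
      rw [abs_le] at hr ht ⊢
      rcases Set.mem_uIcc.1 hx with h | h
      · exact ⟨by linarith, by linarith⟩
      · exact ⟨by linarith, by linarith⟩
    exact (hdiff x h2).trans (by gcongr)

end IsCoupledSolution

/-! ### Multiplication by `z` in the Bargmann–Fock space -/

theorem norm_le_weight_one (z : ℂ) : ‖z‖ ≤ weight 1 z := by
  rw [weight, Real.rpow_one]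
  exact Real.le_sqrt_of_sq_le (by linarith)

theorem weight_one_le (z : ℂ) : weight 1 z ≤ 1 + ‖z‖ := by
  rw [weight, Real.rpow_one, Real.sqrt_le_left (by positivity)]
  nlinarith [norm_nonneg z]

theorem aestronglyMeasurable_toFun (u : BargmannFock) :
    AEStronglyMeasurable (toFun u) (volume : Measure ℂ) := Lp.aestronglyMeasurable _

theorem memLp_toFun (u : BargmannFock) : MemLp (toFun u) 2 (volume : Measure ℂ) :=
  Lp.memLp (u : L2C)

theorem aestronglyMeasurable_mul_toFun (u : BargmannFock) :
    AEStronglyMeasurable (fun z => z * toFun u z) (volume : Measure ℂ) :=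
  continuous_id.aestronglyMeasurable.mul (aestronglyMeasurable_toFun u)

theorem momentL2_iff (u : BargmannFock) : MomentL2 u ↔ WeightedL2 1 u := by
  constructor
  · intro h
    refine ((memLp_toFun u).norm.add h.norm).mono ?_ (Eventually.of_forall fun z => ?_)
    · exact ((Complex.continuous_ofReal.comp (continuous_weight 1)).aestronglyMeasurable.mul
        (aestronglyMeasurable_toFun u))
    · rw [norm_mul, Complex.norm_real, Pi.add_apply, norm_mul,
        Real.norm_of_nonneg (show 0 ≤ Real.sqrt (1 + ‖z‖ ^ 2) ^ (1 : ℝ) from weight_nonneg 1 z),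
        Real.norm_of_nonneg (by positivity), ← one_add_mul]
      exact mul_le_mul_of_nonneg_right (weight_one_le z) (norm_nonneg _)
  · intro h
    refine MemLp.mono h (aestronglyMeasurable_mul_toFun u) (Eventually.of_forall fun z => ?_)
    rw [norm_mul, norm_mul, Complex.norm_real,
      Real.norm_of_nonneg (show 0 ≤ Real.sqrt (1 + ‖z‖ ^ 2) ^ (1 : ℝ) from weight_nonneg 1 z)]
    exact mul_le_mul_of_nonneg_right (norm_le_weight_one z) (norm_nonneg _)

open Classical in
/-- The element `z u` of the Bargmann-Fock space, if `z u ∈ L²`. -/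
def mulZ (u : BargmannFock) : BargmannFock :=
  if h : MomentL2 u then ⟨MemLp.toLp _ h, fun z => z * holo u z,
    differentiable_id.mul (differentiable_holo u), by
      filter_upwards [MemLp.coeFn_toLp h, toFun_ae_eq_rep u] with z h1 h2
      rw [h1, h2, rep, gaussMul, gaussMul]
      ring⟩ else 0

theorem toFun_mulZ {u : BargmannFock} (h : MomentL2 u) :
    toFun (mulZ u) =ᵐ[volume] fun z => z * toFun u z := by
  rw [mulZ, dif_pos h]
  exact MemLp.coeFn_toLp h

theorem eq_of_rep_eq {u v : BargmannFock} (h : rep u = rep v) : u = v := by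
  refine Subtype.ext (Lp.ext ?_)
  have := (toFun_ae_eq_rep u).trans (h ▸ (toFun_ae_eq_rep v).symm)
  exact this

theorem rep_mulZ {u : BargmannFock} (h : MomentL2 u) (z : ℂ) : rep (mulZ u) z = z * rep u z := by
  have h1 : rep (mulZ u) = fun z => z * rep u z := by
    refine rep_eq_of_ae_eq (continuous_id.mul (continuous_rep u)) ?_
    filter_upwards [toFun_mulZ h, toFun_ae_eq_rep u] with z h1 h2
    rw [h1, h2]
  exact congrFun h1 z

/-- Integrability of `z u` follows once `z u` is exhibited pointwise as an element of `ℰ`. -/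
theorem momentL2_of_rep_eq {u w : BargmannFock} (h : ∀ z, z * rep u z = rep w z) : MomentL2 u := by
  refine (memLp_toFun w).ae_eq ?_
  filter_upwards [toFun_ae_eq_rep u, toFun_ae_eq_rep w] with z h1 h2
  rw [h1, h2, h]

theorem rep_neg (u : BargmannFock) : rep (-u) = -rep u := by
  rw [← neg_one_smul ℂ u, rep_smul, neg_one_smul]

theorem rep_sub (u v : BargmannFock) : rep (u - v) = rep u - rep v := by
  rw [sub_eq_add_neg, rep_add, rep_neg, sub_eq_add_neg]

theorem rep_real_smul (r : ℝ) (u : BargmannFock) : rep (r • u) = (r : ℂ) • rep u := by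
  rw [RCLike.real_smul_eq_coe_smul (K := ℂ), rep_smul]
  rfl

theorem MomentL2.sub {u v : BargmannFock} (hu : MomentL2 u) (hv : MomentL2 v) :
    MomentL2 (u - v) :=
  momentL2_of_rep_eq (w := mulZ u - mulZ v) fun z => by
    rw [rep_sub, rep_sub, Pi.sub_apply, Pi.sub_apply, rep_mulZ hu, rep_mulZ hv, mul_sub]

theorem MomentL2.real_smul {u : BargmannFock} (hu : MomentL2 u) (r : ℝ) : MomentL2 (r • u) :=
  momentL2_of_rep_eq (w := r • mulZ u) fun z => by
    rw [rep_real_smul, rep_real_smul, Pi.smul_apply, Pi.smul_apply, rep_mulZ hu, smul_eq_mul,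
      smul_eq_mul, mul_left_comm]

theorem MomentL2.smul {u : BargmannFock} (hu : MomentL2 u) (r : ℂ) : MomentL2 (r • u) :=
  momentL2_of_rep_eq (w := r • mulZ u) fun z => by
    rw [rep_smul, rep_smul, Pi.smul_apply, Pi.smul_apply, rep_mulZ hu, smul_eq_mul,
      smul_eq_mul, mul_left_comm]

theorem mulZ_sub {u v : BargmannFock} (hu : MomentL2 u) (hv : MomentL2 v) :
    mulZ (u - v) = mulZ u - mulZ v :=
  eq_of_rep_eq <| funext fun z => by
    rw [rep_mulZ (hu.sub hv), rep_sub, rep_sub, Pi.sub_apply, Pi.sub_apply, rep_mulZ hu,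
      rep_mulZ hv, mul_sub]

theorem mulZ_smul {u : BargmannFock} (hu : MomentL2 u) (r : ℂ) : mulZ (r • u) = r • mulZ u :=
  eq_of_rep_eq <| funext fun z => by
    rw [rep_mulZ (hu.smul r), rep_smul, rep_smul, Pi.smul_apply, Pi.smul_apply, rep_mulZ hu,
      smul_eq_mul, smul_eq_mul, mul_left_comm]

theorem mulZ_real_smul {u : BargmannFock} (hu : MomentL2 u) (r : ℝ) : mulZ (r • u) = r • mulZ u :=
  eq_of_rep_eq <| funext fun z => by
    rw [rep_mulZ (hu.real_smul r), rep_real_smul, rep_real_smul, Pi.smul_apply, Pi.smul_apply,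
      rep_mulZ hu, smul_eq_mul, smul_eq_mul, mul_left_comm]

/-- Transfers estimates uniform in the truncation to `z u` itself, in particular the quadratic
remainder that gives differentiability in time. -/
theorem norm_mulZ_le {M : ℝ} {u : BargmannFock} (h : ∀ n, ‖weightMul 1 n (u : L2C)‖ ≤ M) :
    ‖mulZ u‖ ≤ M := by
  have hM : 0 ≤ M := (norm_nonneg _).trans (h 0)
  obtain ⟨h1, h2⟩ := weightedL2_of_norm_weightMul_le h
  have hm := (momentL2_iff u).2 h1
  have h3 : ‖(mulZ u : L2C)‖ₑ ^ 2 ≤ ENNReal.ofReal M ^ 2 := by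
    rw [enorm_sq_L2C]
    refine le_trans (lintegral_mono_ae ?_) h2
    filter_upwards [toFun_mulZ hm] with z hz
    change ‖toFun (mulZ u) z‖ₑ ^ 2 ≤ _
    rw [hz, enorm_mul, enorm_mul, ← ofReal_norm z, ← ofReal_norm (weight 1 z : ℂ),
      Complex.norm_real, Real.norm_of_nonneg (weight_nonneg 1 z)]
    gcongr
    exact norm_le_weight_one z
  have h4 := (ENNReal.pow_le_pow_left_iff two_ne_zero).1 h3
  rw [← ofReal_norm, ENNReal.ofReal_le_ofReal_iff hM] at h4
  exact h4

namespace IsCoupledSolution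

variable {c d : ℂ} {B : ℝ} {u v : ℝ → BargmannFock}

theorem momentL2 (h : IsCoupledSolution c d B u v) (h0 : MomentL2 (u 0)) (t : ℝ) :
    MomentL2 (u t) :=
  (momentL2_iff _).2 (h.weightedL2 one_pos ((momentL2_iff _).1 h0) t)

/-- `z u` is differentiable in time if `z u(0) ∈ L²`. -/
theorem hasDerivAt_mulZ (h : IsCoupledSolution c d B u v) (h0 : MomentL2 (u 0)) (t : ℝ) :
    HasDerivAt (fun s => mulZ (u s)) (mulZ (c • nonlin (v t) (u t))) t := by
  have h0' := (momentL2_iff _).1 h0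
  have hd := (momentL2_iff _).2 (h.weightedL2_deriv one_pos h0' t)
  obtain ⟨L, hL0, hL⟩ := h.exists_norm_weightMul_remainder_le one_pos h0' (|t| + 1)
  rw [hasDerivAt_iff_isLittleO]
  refine Asymptotics.IsBigO.trans_isLittleO (g := fun s => ‖s - t‖ ^ 2) ?_
    (Asymptotics.isLittleO_pow_sub_sub t one_lt_two)
  refine Asymptotics.IsBigO.of_bound L ?_
  have hev : ∀ᶠ s in 𝓝 t, |s| < |t| + 1 :=
    continuous_abs.continuousAt.eventually_lt continuousAt_const (by linarith)
  filter_upwards [hev] with s hs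
  rw [← mulZ_sub (h.momentL2 h0 s) (h.momentL2 h0 t), ← mulZ_real_smul hd,
    ← mulZ_sub ((h.momentL2 h0 s).sub (h.momentL2 h0 t)) (hd.real_smul _), norm_pow, norm_norm]
  exact norm_mulZ_le fun n => hL n s t hs.le (by linarith)

end IsCoupledSolution

/-! ### The covariant derivative and integration by parts -/

/-- The covariant derivative `e^{-|z|²/2} (∂f - z̄ f)` of `u = e^{-|z|²/2} f`. -/
def covDeriv (u : BargmannFock) (z : ℂ) : ℂ :=
  gaussMul (fun z => deriv (holo u) z - conj z * holo u z) z

theorem continuous_covDeriv (u : BargmannFock) : Continuous (covDeriv u) := by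
  have h1 := (differentiable_holo u).continuous
  have h2 : Continuous (deriv (holo u)) :=
    ((differentiable_holo u).contDiff (n := 1)).continuous_deriv le_rfl
  unfold covDeriv gaussMul
  fun_prop

/-- Cauchy's estimate on a unit circle around `ζ`, after a factor `e^{-w ζ̄}` that recentres the
Gaussian weight at `ζ`. The constant is uniform in `ζ`, so `D` maps `ℰ` to bounded functions. -/
theorem exists_norm_covDeriv_le : ∃ C : ℝ, ∀ u z, ‖covDeriv u z‖ ≤ C * ‖u‖ := by
  obtain ⟨A, hA, hA'⟩ := exists_norm_rep_le
  refine ⟨A * Real.exp (1 / 2), fun u ζ => ?_⟩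
  set f := holo u with hf
  have hfd : Differentiable ℂ f := differentiable_holo u
  set g : ℂ → ℂ := fun w => f (ζ + w) * Complex.exp (-(w * conj ζ)) with hg
  have hgd : Differentiable ℂ g :=
    (hfd.comp ((differentiable_const ζ).add differentiable_id)).mul (by fun_prop)
  have hder : deriv g 0 = deriv f ζ - conj ζ * f ζ := by
    have h1 : HasDerivAt (fun w => f (ζ + w)) (deriv f ζ) 0 := by
      have := (hfd (ζ + 0)).hasDerivAt.comp_const_add ζ 0
      simpa using this
    have h2 : HasDerivAt (fun w : ℂ => Complex.exp (-(w * conj ζ))) (-(conj ζ)) 0 := by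
      have := (((hasDerivAt_id (0 : ℂ)).mul_const (conj ζ)).neg).cexp
      simpa using this
    have h3 := (h1.mul h2).deriv
    change deriv g 0 = _ at h3
    rw [h3]
    simp
    ring
  have hb : ∀ w ∈ Metric.sphere (0 : ℂ) 1,
      ‖g w‖ ≤ A * ‖u‖ * Real.exp ((‖ζ‖ ^ 2 + 1) / 2) := by
    intro w hw
    have hw1 : ‖w‖ = 1 := by simpa using hw
    have h1 := hA' u (ζ + w)
    have hn : ‖ζ + w‖ ^ 2 = ‖ζ‖ ^ 2 + 2 * (w * conj ζ).re + 1 := by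
      have := norm_sub_sq_complex w (-ζ)
      rw [sub_neg_eq_add, add_comm w ζ, hw1] at this
      rw [this]
      simp
      ring
    -- On the unit circle `|ζ + w|² = |ζ|² + 2 Re(w ζ̄) + 1`, and the exponential factor in `g`
    -- removes the middle term.
    have h2 : ‖g w‖ = ‖rep u (ζ + w)‖ * Real.exp ((‖ζ‖ ^ 2 + 1) / 2) := by
      rw [rep, gaussMul, hg]
      simp only [norm_mul, Complex.norm_exp, Complex.norm_real,
        Real.norm_of_nonneg (Real.exp_pos _).le]
      rw [mul_right_comm, ← Real.exp_add, mul_comm]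
      congr 2
      rw [hn, Complex.neg_re]
      ring
    rw [h2]
    gcongr
  have hcau := Complex.norm_deriv_le_of_forall_mem_sphere_norm_le one_pos
    (hgd.diffContOnCl) hb
  rw [covDeriv, gaussMul, ← hder, norm_mul, Complex.norm_real,
    Real.norm_of_nonneg (Real.exp_pos _).le]
  calc _ ≤ Real.exp (-‖ζ‖ ^ 2 / 2) * (A * ‖u‖ * Real.exp ((‖ζ‖ ^ 2 + 1) / 2) / 1) := by gcongr
    _ = A * (Real.exp (-‖ζ‖ ^ 2 / 2) * Real.exp ((‖ζ‖ ^ 2 + 1) / 2)) * ‖u‖ := by ring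
    _ = _ := by
      rw [← Real.exp_add]
      congr 3
      ring

theorem memLp_top_covDeriv (u : BargmannFock) : MemLp (covDeriv u) ⊤ (volume : Measure ℂ) := by
  obtain ⟨C, hC⟩ := exists_norm_covDeriv_le
  exact memLp_top_of_bound (continuous_covDeriv u).aestronglyMeasurable (C * ‖u‖)
    (Eventually.of_forall (hC u))

theorem memLp_rep (u : BargmannFock) : MemLp (rep u) 2 (volume : Measure ℂ) :=
  (memLp_toFun u).ae_eq (toFun_ae_eq_rep u)

theorem memLp_top_rep (u : BargmannFock) : MemLp (rep u) ⊤ (volume : Measure ℂ) :=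
  (memLp_toFun_top u).ae_eq (toFun_ae_eq_rep u)

theorem integrable_of_norm_eq_mul {H a b c d : ℂ → ℂ} (hH : Continuous H)
    (ha : MemLp a 2 (volume : Measure ℂ)) (hb : MemLp b 2 (volume : Measure ℂ))
    (hc : MemLp c ⊤ (volume : Measure ℂ)) (hd : MemLp d ⊤ (volume : Measure ℂ))
    (h : ∀ z, ‖H z‖ = ‖a z‖ * ‖b z‖ * ‖c z‖ * ‖d z‖) : Integrable H := by
  have h1 : MemLp (fun z => d z * (c z * (b z * a z))) 1 (volume : Measure ℂ) :=
    ((ha.mul (r := 1) hb).mul (r := 1) hc).mul (r := 1) hd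
  refine (memLp_one_iff_integrable.1 h1).mono hH.aestronglyMeasurable
    (Eventually.of_forall fun z => ?_)
  rw [h, norm_mul, norm_mul, norm_mul]
  exact le_of_eq (by ring)

theorem hasDerivAt_line {f : ℂ → ℂ} (hf : Differentiable ℂ f) (z v : ℂ) :
    HasDerivAt (fun t : ℝ => f (z + t * v)) (deriv f z * v) 0 := by
  have h1 : HasDerivAt (fun t : ℝ => z + (t : ℂ) * v) v 0 := by
    have := ((Complex.ofRealCLM.hasDerivAt (x := (0 : ℝ))).mul_const v).const_add z
    simpa using this
  have h2 : HasDerivAt f (deriv f z) (z + ((0 : ℝ) : ℂ) * v) := by simpa using (hf z).hasDerivAt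
  exact h2.comp (0 : ℝ) h1

theorem hasDerivAt_exp_line (z v : ℂ) :
    HasDerivAt (fun t : ℝ => ((Real.exp (-‖z + t * v‖ ^ 2 / 2) : ℝ) : ℂ))
      (-((Real.exp (-‖z‖ ^ 2 / 2) : ℝ) : ℂ) * ((z * conj v).re : ℂ)) 0 := by
  have h1 : HasDerivAt (fun t : ℝ => -‖z + t * v‖ ^ 2 / 2) (-(z * conj v).re) 0 := by
    have e : (fun t : ℝ => -‖z + t * v‖ ^ 2 / 2) = fun t : ℝ =>
        -(‖z‖ ^ 2 + t * (2 * (z * conj v).re) + t ^ 2 * ‖v‖ ^ 2) / 2 := by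
      ext t
      have := norm_sub_sq_complex z (-(t * v))
      rw [sub_neg_eq_add] at this
      rw [this]
      simp [mul_pow, mul_comm, mul_left_comm]
      ring
    rw [e]
    have h2 := (((((hasDerivAt_id (0 : ℝ)).mul_const (2 * (z * conj v).re)).const_add
      (‖z‖ ^ 2)).add (((hasDerivAt_id (0 : ℝ)).pow 2).mul_const (‖v‖ ^ 2))).neg).div_const 2
    refine h2.congr_deriv ?_
    simp
    ring
  have h3 := h1.exp.ofReal_comp
  refine h3.congr_deriv ?_
  rw [Complex.ofReal_zero, zero_mul, add_zero]
  push_cast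
  ring

/-- The gradient of `u` is a covariant part linear in `v`, plus a purely imaginary multiple of `u`
that depends only on `z` and `v`. The latter cancels in products with as many conjugated as
unconjugated factors. -/
theorem hasDerivAt_rep_line (u : BargmannFock) (z v : ℂ) :
    HasDerivAt (fun t : ℝ => rep u (z + t * v))
      (covDeriv u z * v + rep u z * ((conj z * v).im * Complex.I)) 0 := by
  have h := (hasDerivAt_exp_line z v).mul (hasDerivAt_line (differentiable_holo u) z v)
  refine h.congr_deriv ?_
  have e : ((z * conj v).re : ℂ) = conj z * v - ((conj z * v).im : ℂ) * Complex.I := by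
    apply Complex.ext <;> simp
  rw [e]
  simp only [covDeriv, rep, gaussMul, Complex.ofReal_zero, zero_mul, add_zero]
  ring

/-- Integration by parts in the Bargmann-Fock space of twice the weight: the covariant derivative
of a product is orthogonal to products. -/
theorem integral_conj_covDeriv_mul (a b c d : BargmannFock) :
    ∫ z, (conj (covDeriv a z * rep b z + rep a z * covDeriv b z) * (rep c z * rep d z)) = 0 := by
  have ca := continuous_rep a
  have cb := continuous_rep b
  have cc := continuous_rep c
  have cd := continuous_rep d
  have da := continuous_covDeriv a
  have db := continuous_covDeriv b
  have dc := continuous_covDeriv c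
  have dd := continuous_covDeriv d
  set H : ℂ → ℂ := fun z => conj (rep a z * rep b z) * (rep c z * rep d z) with hH
  set P : ℂ → ℂ := fun z =>
    conj (covDeriv a z * rep b z + rep a z * covDeriv b z) * (rep c z * rep d z) with hP
  set Q : ℂ → ℂ := fun z =>
    conj (rep a z * rep b z) * (covDeriv c z * rep d z + rep c z * covDeriv d z) with hQ
  have iH : Integrable H := by
    refine integrable_of_norm_eq_mul (by fun_prop) (memLp_rep a) (memLp_rep b) (memLp_top_rep c)
      (memLp_top_rep d) fun z => ?_
    simp only [hH, norm_mul, RCLike.norm_conj]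
    ring
  have iP : Integrable P := by
    have e : P = fun z => conj (covDeriv a z * rep b z) * (rep c z * rep d z) +
        conj (rep a z * covDeriv b z) * (rep c z * rep d z) := by
      ext z
      simp only [hP, map_add]
      ring
    rw [e]
    refine Integrable.add ?_ ?_
    · refine integrable_of_norm_eq_mul (by fun_prop) (memLp_rep c) (memLp_rep d)
        (memLp_top_covDeriv a) (memLp_top_rep b) fun z => ?_
      simp only [norm_mul, RCLike.norm_conj]
      ring
    · refine integrable_of_norm_eq_mul (by fun_prop) (memLp_rep c) (memLp_rep d)
        (memLp_top_rep a) (memLp_top_covDeriv b) fun z => ?_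
      simp only [norm_mul, RCLike.norm_conj]
      ring
  have iQ : Integrable Q := by
    have e : Q = fun z => conj (rep a z * rep b z) * (covDeriv c z * rep d z) +
        conj (rep a z * rep b z) * (rep c z * covDeriv d z) := by
      ext z
      simp only [hQ]
      ring
    rw [e]
    refine Integrable.add ?_ ?_
    · refine integrable_of_norm_eq_mul (by fun_prop) (memLp_rep a) (memLp_rep b)
        (memLp_top_covDeriv c) (memLp_top_rep d) fun z => ?_
      simp only [norm_mul, RCLike.norm_conj]
      ring
    · refine integrable_of_norm_eq_mul (by fun_prop) (memLp_rep a) (memLp_rep b)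
        (memLp_top_rep c) (memLp_top_covDeriv d) fun z => ?_
      simp only [norm_mul, RCLike.norm_conj]
      ring
  have hline : ∀ z v, HasLineDerivAt ℝ H (conj v * P z + v * Q z) z v := by
    intro z v
    have hconj : ∀ {f : ℝ → ℂ} {f' : ℂ}, HasDerivAt f f' 0 →
        HasDerivAt (fun t => conj (f t)) (conj f') 0 := fun hf =>
      (Complex.conjCLE : ℂ →L[ℝ] ℂ).hasFDerivAt.comp_hasDerivAt (0 : ℝ) hf
    have h1 := (hconj ((hasDerivAt_rep_line a z v).mul (hasDerivAt_rep_line b z v))).mul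
      ((hasDerivAt_rep_line c z v).mul (hasDerivAt_rep_line d z v))
    change HasDerivAt (fun t : ℝ => H (z + t • v)) _ 0
    refine h1.congr_deriv ?_
    simp only [Complex.ofReal_zero, zero_mul, add_zero, map_add, map_mul, Complex.conj_I,
      Complex.conj_ofReal, hP, hQ, Pi.mul_apply]
    ring
  -- The integral of a directional derivative vanishes, by integration by parts against the constant
  -- `1`. The directions `1` and `i` give `∫ P = -∫ Q` and `∫ P = ∫ Q`, so both integrals are zero.
  have hzero : ∀ v : ℂ, conj v * ∫ z, P z = -(v * ∫ z, Q z) := by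
    intro v
    have i1 : Integrable fun z => conj v * P z + v * Q z := (iP.const_mul _).add (iQ.const_mul _)
    have h := integral_bilinear_hasLineDerivAt_right_eq_neg_left_of_integrable
      (μ := (volume : Measure ℂ)) (f := H) (f' := fun z => conj v * P z + v * Q z)
      (g := fun _ => (1 : ℂ)) (g' := fun _ => 0) (v := v) (B := ContinuousLinearMap.mul ℝ ℂ)
      (by simpa using i1) (by simp) (by simpa using iH)
      (fun z _ => hline z v) (fun z _ => (hasDerivAt_const (0 : ℝ) (1 : ℂ)))
    simp only [ContinuousLinearMap.mul_apply', mul_zero, integral_zero, mul_one] at h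
    rw [integral_add (iP.const_mul _) (iQ.const_mul _), integral_const_mul,
      integral_const_mul] at h
    linear_combination h
  have h1 := hzero 1
  have hI := hzero Complex.I
  simp only [map_one, one_mul, Complex.conj_I] at h1 hI
  have h2 : Complex.I * ∫ z, P z = 0 := by linear_combination (Complex.I * h1 - hI) / 2
  exact (mul_eq_zero.1 h2).resolve_left Complex.I_ne_zero

theorem holo_eq_of_rep_eq {u : BargmannFock} {g : ℂ → ℂ} (h : rep u = gaussMul g) :
    holo u = g := by
  ext z
  have h1 := congrFun h z
  rw [rep, gaussMul, gaussMul] at h1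
  exact mul_left_cancel₀ (Complex.ofReal_ne_zero.2 (Real.exp_pos _).ne') h1

/-- The conjugate factor `ζ - z` on the kernel is what converts multiplication by `ζ` outside the
projection into multiplication by `z` inside it. -/
theorem covDeriv_kernel (ζ z : ℂ) :
    covDeriv (kernel ζ) z = (conj ζ - conj z) * rep (kernel ζ) z := by
  have h1 : holo (kernel ζ) = kernelHolo ζ := holo_eq_of_rep_eq (rep_kernel ζ)
  have h2 : deriv (kernelHolo ζ) z = conj ζ * kernelHolo ζ z := by
    have h3 : HasDerivAt (kernelHolo ζ) (kernelHolo ζ z * (1 * conj ζ)) z :=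
      (((hasDerivAt_id z).mul_const (conj ζ)).sub_const ((‖ζ‖ : ℂ) ^ 2 / 2)).cexp
    rw [h3.deriv]
    ring
  simp only [covDeriv, rep, gaussMul, h1, h2]
  ring

theorem covDeriv_mulZ {u : BargmannFock} (hu : MomentL2 u) (z : ℂ) :
    covDeriv (mulZ u) z = rep u z + z * covDeriv u z := by
  have h1 : holo (mulZ u) = fun z => z * holo u z := by
    refine holo_eq_of_rep_eq (funext fun z => ?_)
    rw [rep_mulZ hu, rep, gaussMul, gaussMul]
    ring
  have h2 : deriv (fun z => z * holo u z) z = holo u z + z * deriv (holo u) z := by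
    have h3 : HasDerivAt (fun z => z * holo u z) (1 * holo u z + z * deriv (holo u) z) z :=
      (hasDerivAt_id z).mul (differentiable_holo u z).hasDerivAt
    rw [h3.deriv, one_mul]
  simp only [covDeriv, rep, gaussMul, h1, h2]
  ring

/-! ### Commuting `z` with the nonlinearity, and the cancellations between the two equations -/

theorem memLp_covTriple (v u : BargmannFock) :
    MemLp (fun z => conj (covDeriv v z) * (rep v z * rep u z)) 2 (volume : Measure ℂ) :=
  ((memLp_rep u).mul (r := 2) (memLp_top_rep v)).mul (r := 2) (memLp_top_covDeriv v).star

/-- The element `conj(Dv) v u` of `L²`, where `D` is the covariant derivative. -/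
def covTriple (v u : BargmannFock) : L2C := (memLp_covTriple v u).toLp

theorem coeFn_covTriple (v u : BargmannFock) :
    covTriple v u =ᵐ[volume] fun z => conj (covDeriv v z) * (rep v z * rep u z) :=
  (memLp_covTriple v u).coeFn_toLp

theorem coeFn_tripleProduct_rep (a b c : BargmannFock) :
    tripleProduct a b c =ᵐ[volume] fun z => rep a z * (conj (rep b z) * rep c z) := by
  filter_upwards [coeFn_tripleProduct a b c, toFun_ae_eq_rep a, toFun_ae_eq_rep b,
    toFun_ae_eq_rep c] with z h1 h2 h3 h4
  rw [h1, h2, h3, h4]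

theorem inner_eq_integral_of_ae_eq (a : BargmannFock) {h : L2C} {g : ℂ → ℂ}
    (hg : h =ᵐ[volume] g) : inner ℂ (a : L2C) h = ∫ z, conj (rep a z) * g z := by
  rw [L2.inner_def]
  refine integral_congr_ae ?_
  filter_upwards [hg, toFun_ae_eq_rep a] with z h1 h2
  rw [RCLike.inner_apply, h1, ← h2, mul_comm]
  rfl

/-- The Leibniz rule `z Π(|v|² u) = Π(|v|² z u - conj(Dv) v u)`. -/
theorem mul_rep_nonlin {u : BargmannFock} (hu : MomentL2 u) (v : BargmannFock) (ζ : ℂ) :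
    ζ * rep (nonlin v u) ζ = rep (proj (tripleProduct v v (mulZ u) - covTriple v u)) ζ := by
  -- As `conj(D k) = (ζ - z) conj k` for the kernel `k`, the pairing equals `∫ conj(Dv k + v Dk) u
  -- v`, which vanishes by integration by parts.
  have key : inner ℂ (kernel ζ : L2C)
      (ζ • tripleProduct v v u - (tripleProduct v v (mulZ u) - covTriple v u)) = 0 := by
    rw [inner_eq_integral_of_ae_eq (kernel ζ) (g := fun z => ζ * (rep v z * (conj (rep v z) *
      rep u z)) - (rep v z * (conj (rep v z) * (z * rep u z)) -
        conj (covDeriv v z) * (rep v z * rep u z)))]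
    · rw [← integral_conj_covDeriv_mul v (kernel ζ) u v]
      congr 1 with z
      rw [covDeriv_kernel]
      simp only [map_add, map_mul, map_sub, Complex.conj_conj]
      ring
    · filter_upwards [Lp.coeFn_sub (ζ • tripleProduct v v u)
        (tripleProduct v v (mulZ u) - covTriple v u), Lp.coeFn_smul ζ (tripleProduct v v u),
        Lp.coeFn_sub (tripleProduct v v (mulZ u)) (covTriple v u), coeFn_tripleProduct_rep v v u,
        coeFn_tripleProduct_rep v v (mulZ u), coeFn_covTriple v u] with z h1 h2 h3 h4 h5 h6
      rw [h1, Pi.sub_apply, h2, Pi.smul_apply, h3, Pi.sub_apply, h4, h5, h6, rep_mulZ hu,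
        smul_eq_mul]
  have h1 := inner_kernel ζ
    (proj (ζ • tripleProduct v v u - (tripleProduct v v (mulZ u) - covTriple v u)))
  rw [inner_proj, key, eq_comm, mul_eq_zero] at h1
  have h2 := h1.resolve_left (Complex.ofReal_ne_zero.2 gaussMass_toReal_pos.ne')
  rw [map_sub, map_smul, rep_sub, rep_smul, Pi.sub_apply, Pi.smul_apply, sub_eq_zero] at h2
  rw [nonlin_eq, ← h2, smul_eq_mul]

theorem MomentL2.nonlin {u : BargmannFock} (hu : MomentL2 u) (v : BargmannFock) :
    MomentL2 (nonlin v u) :=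
  momentL2_of_rep_eq (mul_rep_nonlin hu v)

theorem mulZ_nonlin {u : BargmannFock} (hu : MomentL2 u) (v : BargmannFock) :
    mulZ (nonlin v u) = proj (tripleProduct v v (mulZ u) - covTriple v u) :=
  eq_of_rep_eq <| funext fun z => by rw [rep_mulZ (hu.nonlin v), mul_rep_nonlin hu v]

theorem inner_covTriple (a v u : BargmannFock) :
    inner ℂ (a : L2C) (covTriple v u) =
      ∫ z, conj (rep a z) * (conj (covDeriv v z) * (rep v z * rep u z)) :=
  inner_eq_integral_of_ae_eq a (coeFn_covTriple v u)

theorem integrable_inner_covTriple (a v u : BargmannFock) :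
    Integrable fun z => conj (rep a z) * (conj (covDeriv v z) * (rep v z * rep u z)) := by
  have ca := continuous_rep a
  have cv := continuous_rep v
  have cu := continuous_rep u
  have dv := continuous_covDeriv v
  refine integrable_of_norm_eq_mul (by fun_prop) (memLp_rep a) (memLp_rep u) (memLp_top_rep v)
    (memLp_top_covDeriv v) fun z => ?_
  simp only [norm_mul, RCLike.norm_conj]
  ring

/-- The sum is `∫ conj(Du v + u Dv) u v`. This is the cancellation behind the magnetic momentum. -/
theorem inner_covTriple_add_swap (u v : BargmannFock) :
    inner ℂ (u : L2C) (covTriple v u) + inner ℂ (v : L2C) (covTriple u v) = 0 := by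
  rw [inner_covTriple, inner_covTriple, ← integral_add (integrable_inner_covTriple _ _ _)
    (integrable_inner_covTriple _ _ _), ← integral_conj_covDeriv_mul u v u v]
  congr 1 with z
  simp only [map_add, map_mul]
  ring

theorem hamiltonian_eq_rep (u v : BargmannFock) :
    (hamiltonian u v : ℂ) = ∫ z, conj (rep u z) * (rep v z * (conj (rep v z) * rep u z)) := by
  rw [← inner_nonlin_self]
  exact inner_eq_integral_of_ae_eq u (coeFn_tripleProduct_rep v v u)

/-- Integration by parts with `zu` and `v` conjugated; since `D(zu) = u + z Du`, an extra
Hamiltonian appears. Only its being real matters for the angular momentum. -/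
theorem inner_mulZ_covTriple_add_swap {u v : BargmannFock} (hu : MomentL2 u) (hv : MomentL2 v) :
    inner ℂ (mulZ u : L2C) (covTriple v u) + inner ℂ (mulZ v : L2C) (covTriple u v) =
      -(hamiltonian u v : ℂ) := by
  have hi : Integrable fun z => conj (rep u z) * (rep v z * (conj (rep v z) * rep u z)) := by
    have cv := continuous_rep v
    have cu := continuous_rep u
    refine integrable_of_norm_eq_mul (by fun_prop) (memLp_rep u) (memLp_rep v) (memLp_top_rep u)
      (memLp_top_rep v) fun z => ?_
    simp only [norm_mul, RCLike.norm_conj]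
    ring
  have i1 := integrable_inner_covTriple (mulZ u) v u
  have i2 := integrable_inner_covTriple (mulZ v) u v
  have i3 : Integrable fun z =>
      conj (rep (mulZ u) z) * (conj (covDeriv v z) * (rep v z * rep u z)) +
        conj (rep (mulZ v) z) * (conj (covDeriv u z) * (rep u z * rep v z)) := i1.add i2
  have h := integral_conj_covDeriv_mul (mulZ u) v u v
  rw [inner_covTriple, inner_covTriple, hamiltonian_eq_rep, eq_neg_iff_add_eq_zero,
    ← integral_add i1 i2, ← integral_add i3 hi, ← h]
  congr 1 with z
  rw [covDeriv_mulZ hu, rep_mulZ hu, rep_mulZ hv]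
  simp only [map_add, map_mul]
  ring

/-! ### Conservation of the momenta -/

theorem integrable_mul_sq_norm {u : BargmannFock} (hu : MomentL2 u) :
    Integrable fun z => z * ((‖toFun u z‖ ^ 2 : ℝ) : ℂ) := by
  have h : Integrable fun z => (z * toFun u z) * conj (toFun u z) :=
    hu.integrable_mul (memLp_toFun u).star
  refine h.congr (Eventually.of_forall fun z => ?_)
  simp only [mul_assoc, Complex.mul_conj', Complex.ofReal_pow]

theorem inner_mulZ {u : BargmannFock} (hu : MomentL2 u) :
    inner ℂ u (mulZ u) = ∫ z, z * ((‖toFun u z‖ ^ 2 : ℝ) : ℂ) := by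
  rw [Submodule.coe_inner, L2.inner_def]
  refine integral_congr_ae ?_
  filter_upwards [toFun_mulZ hu] with z hz
  change inner ℂ (toFun u z) (toFun (mulZ u) z) = _
  rw [hz, RCLike.inner_apply, mul_assoc]
  exact congrArg (z * ·) (by rw [Complex.mul_conj', Complex.ofReal_pow])

theorem magneticMomentum_eq (σ : ℝ) {u v : BargmannFock} (hu : MomentL2 u) (hv : MomentL2 v) :
    magneticMomentum σ u v = inner ℂ u (mulZ u) + σ * inner ℂ v (mulZ v) := by
  rw [inner_mulZ hu, inner_mulZ hv, ← integral_const_mul,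
    ← integral_add (integrable_mul_sq_norm hu) ((integrable_mul_sq_norm hv).const_mul _)]
  refine integral_congr_ae (Eventually.of_forall fun z => ?_)
  push_cast
  ring

theorem integrable_sq_norm_mul_sq_norm {u : BargmannFock} (hu : MomentL2 u) :
    Integrable fun z => ‖z‖ ^ 2 * ‖toFun u z‖ ^ 2 := by
  refine ((memLp_two_iff_integrable_sq_norm hu.1).1 hu).congr (Eventually.of_forall fun z => ?_)
  simp only [norm_mul, mul_pow]

theorem norm_mulZ_sq {u : BargmannFock} (hu : MomentL2 u) :
    ‖mulZ u‖ ^ 2 = ∫ z, ‖z‖ ^ 2 * ‖toFun u z‖ ^ 2 := by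
  rw [← mass_eq, mass]
  refine integral_congr_ae ?_
  filter_upwards [toFun_mulZ hu] with z hz
  rw [hz, norm_mul, mul_pow]

theorem angularMomentum_eq (σ : ℝ) {u v : BargmannFock} (hu : MomentL2 u) (hv : MomentL2 v) :
    angularMomentum σ u v =
      ‖mulZ u‖ ^ 2 - ‖u‖ ^ 2 + σ * (‖mulZ v‖ ^ 2 - ‖v‖ ^ 2) := by
  have hi : ∀ w : BargmannFock, Integrable fun z => ‖toFun w z‖ ^ 2 := fun w =>
    (memLp_two_iff_integrable_sq_norm (memLp_toFun w).1).1 (memLp_toFun w)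
  have hs : ∀ {w : BargmannFock}, MomentL2 w →
      Integrable fun z => ‖z‖ ^ 2 * ‖toFun w z‖ ^ 2 - ‖toFun w z‖ ^ 2 := fun hw =>
    (integrable_sq_norm_mul_sq_norm hw).sub (hi _)
  rw [norm_mulZ_sq hu, norm_mulZ_sq hv, ← mass_eq u, ← mass_eq v, mass, mass,
    ← integral_sub (integrable_sq_norm_mul_sq_norm hu) (hi u),
    ← integral_sub (integrable_sq_norm_mul_sq_norm hv) (hi v), ← integral_const_mul,
    ← integral_add (hs hu) ((hs hv).const_mul σ)]
  refine integral_congr_ae (Eventually.of_forall fun z => ?_)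
  ring

namespace IsCoupledSolution

variable {d : ℂ} {B τ : ℝ} {u v : ℝ → BargmannFock}

/-- Multiplications by `|v|²` and by `z` commute, so the two terms `⟨u, |v|² z u⟩` cancel and only
the commutator term is left. -/
theorem hasDerivAt_inner_mulZ (h : IsCoupledSolution (-Complex.I * τ) d B u v)
    (h0 : MomentL2 (u 0)) (t : ℝ) :
    HasDerivAt (fun s => inner ℂ (u s) (mulZ (u s)))
      (Complex.I * τ * inner ℂ (u t : L2C) (covTriple (v t) (u t))) t := by
  have hu := h.momentL2 h0 t
  refine ((h.hasDerivAt_left t).inner ℂ (h.hasDerivAt_mulZ h0 t)).congr_deriv ?_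
  have e : inner ℂ (nonlin (v t) (u t)) (mulZ (u t)) =
      inner ℂ (u t : L2C) (tripleProduct (v t) (v t) (mulZ (u t))) := by
    rw [nonlin_eq, ← inner_conj_symm, inner_proj, conj_inner_tripleProduct, tripleProduct_comm,
      inner_tripleProduct_swap]
  rw [mulZ_smul (hu.nonlin _), mulZ_nonlin hu, inner_smul_right, inner_smul_left, inner_proj,
    inner_sub_right, e]
  simp only [map_mul, map_neg, Complex.conj_I, Complex.conj_ofReal]
  ring

/-- The term `⟨zu, |v|² zu⟩` is real and drops out; what remains comes from the commutator. -/
theorem hasDerivAt_norm_mulZ_sq (h : IsCoupledSolution (-Complex.I * τ) d B u v)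
    (h0 : MomentL2 (u 0)) (t : ℝ) :
    HasDerivAt (fun s => ‖mulZ (u s)‖ ^ 2)
      (-2 * τ * (inner ℂ (mulZ (u t) : L2C) (covTriple (v t) (u t))).im) t := by
  have hu := h.momentL2 h0 t
  have hz := h.hasDerivAt_mulZ h0 t
  have hd := Complex.reCLM.hasFDerivAt.comp_hasDerivAt t (hz.inner ℂ hz)
  have e : (fun s => ‖mulZ (u s)‖ ^ 2) =
      Complex.reCLM ∘ fun s => inner ℂ (mulZ (u s)) (mulZ (u s)) := by
    ext s
    exact norm_sq_eq_re_inner (𝕜 := ℂ) _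
  rw [e]
  refine hd.congr_deriv ?_
  rw [← inner_conj_symm (mulZ ((-Complex.I * τ) • nonlin (v t) (u t))), mulZ_smul (hu.nonlin _),
    mulZ_nonlin hu, inner_smul_right, inner_proj, inner_sub_right, inner_nonlin_self]
  simp [-inner_conj_symm]
  ring

end IsCoupledSolution

section Conservation

variable {σ : ℝ} {B : ℝ} {u v : ℝ → BargmannFock}

theorem magneticMomentum_eq_of_isCoupledSolution (hσ : σ ^ 2 = 1)
    (h : IsCoupledSolution (-Complex.I) (-Complex.I * σ) B u v) (hu : MomentL2 (u 0))
    (hv : MomentL2 (v 0)) (t : ℝ) :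
    magneticMomentum σ (u t) (v t) = magneticMomentum σ (u 0) (v 0) := by
  have h' : IsCoupledSolution (-Complex.I * (1 : ℝ)) (-Complex.I * σ) B u v := by simpa using h
  have hd : ∀ t, HasDerivAt (fun s => magneticMomentum σ (u s) (v s)) 0 t := fun t => by
    simp only [fun s => magneticMomentum_eq σ (h'.momentL2 hu s) (h'.symm.momentL2 hv s)]
    refine ((h'.hasDerivAt_inner_mulZ hu t).add
      ((h'.symm.hasDerivAt_inner_mulZ hv t).const_mul (σ : ℂ))).congr_deriv ?_
    have hσ' : (σ : ℂ) ^ 2 = 1 := by exact_mod_cast hσ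
    push_cast
    -- The `v` contribution carries one `σ` from the momentum and one from the equation; `σ² = 1`
    -- makes the two contributions cancel.
    linear_combination Complex.I * inner_covTriple_add_swap (u t) (v t) +
      Complex.I * inner ℂ (v t : L2C) (covTriple (u t) (v t)) * hσ'
  exact is_const_of_deriv_eq_zero (fun t => (hd t).differentiableAt) (fun t => (hd t).deriv) t 0

theorem angularMomentum_eq_of_isCoupledSolution (hσ : σ ^ 2 = 1)
    (h : IsCoupledSolution (-Complex.I) (-Complex.I * σ) B u v) (hu : MomentL2 (u 0))
    (hv : MomentL2 (v 0)) (hnu : ∀ t, ‖u t‖ = ‖u 0‖) (hnv : ∀ t, ‖v t‖ = ‖v 0‖) (t : ℝ) :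
    angularMomentum σ (u t) (v t) = angularMomentum σ (u 0) (v 0) := by
  have h' : IsCoupledSolution (-Complex.I * (1 : ℝ)) (-Complex.I * σ) B u v := by simpa using h
  have hd : ∀ t, HasDerivAt (fun s => angularMomentum σ (u s) (v s)) 0 t := fun t => by
    -- Conservation of the masses turns the `-1` in the weight `|z|² - 1` into constants in time, so
    -- only `‖zu‖² + σ ‖zv‖²` is differentiated.
    simp only [fun s => angularMomentum_eq σ (h'.momentL2 hu s) (h'.symm.momentL2 hv s), hnu, hnv]
    refine (((h'.hasDerivAt_norm_mulZ_sq hu t).sub_const (‖u 0‖ ^ 2)).add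
      (((h'.symm.hasDerivAt_norm_mulZ_sq hv t).sub_const (‖v 0‖ ^ 2)).const_mul σ)).congr_deriv ?_
    have e := congrArg Complex.im
      (inner_mulZ_covTriple_add_swap (h'.momentL2 hu t) (h'.symm.momentL2 hv t))
    simp only [Complex.add_im, Complex.neg_im, Complex.ofReal_im, neg_zero] at e
    linear_combination (-2) * e -
      2 * (inner ℂ (mulZ (v t) : L2C) (covTriple (u t) (v t))).im * hσ
  exact is_const_of_deriv_eq_zero (fun t => (hd t).differentiableAt) (fun t => (hd t).deriv) t 0

end Conservation

end LLL

end

theorem theorem1p1 (σ : ℝ) (hσ : σ = 1 ∨ σ = -1) :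
    ∃ Φ : ℝ → LLL.BargmannFock × LLL.BargmannFock → LLL.BargmannFock × LLL.BargmannFock,
      ContDiff ℝ ∞ (fun p : ℝ × (LLL.BargmannFock × LLL.BargmannFock) => Φ p.1 p.2) ∧
      ∀ u₀ v₀ : LLL.BargmannFock,
        (ContDiff ℝ ∞ (fun t => Φ t (u₀, v₀)) ∧ LLL.IsSolution σ (u₀, v₀) (fun t => Φ t (u₀, v₀))) ∧
        (∀ U : ℝ → LLL.BargmannFock × LLL.BargmannFock,
          ContDiff ℝ ∞ U → LLL.IsSolution σ (u₀, v₀) U → U = fun t => Φ t (u₀, v₀)) ∧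
        (∀ t : ℝ,
          LLL.mass (Φ t (u₀, v₀)).1 = LLL.mass u₀ ∧
          LLL.mass (Φ t (u₀, v₀)).2 = LLL.mass v₀ ∧
          MeasureTheory.Integrable (fun z : ℂ => ‖LLL.toFun (Φ t (u₀, v₀)).1 z‖ ^ 2 *
            ‖LLL.toFun (Φ t (u₀, v₀)).2 z‖ ^ 2) ∧
          LLL.hamiltonian (Φ t (u₀, v₀)).1 (Φ t (u₀, v₀)).2 = LLL.hamiltonian u₀ v₀) ∧
        (LLL.MomentL2 u₀ → LLL.MomentL2 v₀ → ∀ t : ℝ,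
          LLL.MomentL2 (Φ t (u₀, v₀)).1 ∧ LLL.MomentL2 (Φ t (u₀, v₀)).2 ∧
          LLL.angularMomentum σ (Φ t (u₀, v₀)).1 (Φ t (u₀, v₀)).2 =
            LLL.angularMomentum σ u₀ v₀ ∧
          LLL.magneticMomentum σ (Φ t (u₀, v₀)).1 (Φ t (u₀, v₀)).2 =
            LLL.magneticMomentum σ u₀ v₀) ∧
        (∀ s : ℝ, 0 < s → LLL.WeightedL2 s u₀ → LLL.WeightedL2 s v₀ → ∀ t : ℝ,
          LLL.WeightedL2 s (Φ t (u₀, v₀)).1 ∧ LLL.WeightedL2 s (Φ t (u₀, v₀)).2) := by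
  have hσ2 : σ ^ 2 = 1 := by rcases hσ with rfl | rfl <;> norm_num
  have hM := LLL.conservesNorm_vectorField σ
  have hΦ := hM.contDiff_flow.of_le (m := ∞) le_top
  refine ⟨hM.flow, hΦ, fun u₀ v₀ => ?_⟩
  have h0 : hM.flow 0 (u₀, v₀) = (u₀, v₀) := hM.flow_zero _
  have hd := hM.hasDerivAt_flow (u₀, v₀)
  have hn : ∀ t, ‖(hM.flow t (u₀, v₀)).1‖ = ‖u₀‖ ∧ ‖(hM.flow t (u₀, v₀)).2‖ = ‖v₀‖ := fun t => by
    have h := LLL.norms_eq_of_hasDerivAt_vectorField (c := fun _ => 1)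
      (fun t => by simpa only [one_smul] using hd t) t
    rwa [h0] at h
  -- The conserved norms give the uniform bound. Results proved for the first component apply to the
  -- second by exchanging the two equations.
  have hc : LLL.IsCoupledSolution (-Complex.I) (-Complex.I * σ) (max ‖u₀‖ ‖v₀‖)
      (fun t => (hM.flow t (u₀, v₀)).1) (fun t => (hM.flow t (u₀, v₀)).2) :=
    ⟨fun t => (LLL.hasDerivAt_components (hd t)).1, fun t => (LLL.hasDerivAt_components (hd t)).2,
      fun t => (hn t).1.le.trans (le_max_left _ _), fun t => (hn t).2.le.trans (le_max_right _ _)⟩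
  have e1 : (hM.flow 0 (u₀, v₀)).1 = u₀ := by rw [h0]
  have e2 : (hM.flow 0 (u₀, v₀)).2 = v₀ := by rw [h0]
  refine ⟨⟨hΦ.comp (contDiff_id.prodMk contDiff_const),
    (LLL.isSolution_iff _ _ _).2 ⟨h0, hd⟩⟩, fun U _ hU => ?_, fun t => ⟨?_, ?_, ?_, ?_⟩,
    fun hu hv t => ?_, fun s hs hu hv t => ⟨?_, ?_⟩⟩
  · obtain ⟨hU0, hU1⟩ := (LLL.isSolution_iff _ _ _).1 hU
    rw [← hU0]
    exact hM.eq_flow hU1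
  · rw [LLL.mass_eq, LLL.mass_eq, (hn t).1]
  · rw [LLL.mass_eq, LLL.mass_eq, (hn t).2]
  · exact LLL.integrable_hamiltonian _ _
  · have h := LLL.hamiltonian_eq_of_hasDerivAt hd t
    rwa [e1, e2] at h
  · rw [← e1] at hu
    rw [← e2] at hv
    have hP := LLL.angularMomentum_eq_of_isCoupledSolution hσ2 hc hu hv
      (fun t => by rw [(hn t).1, e1]) (fun t => by rw [(hn t).2, e2]) t
    have hQ := LLL.magneticMomentum_eq_of_isCoupledSolution hσ2 hc hu hv t
    simp only [e1, e2] at hP hQ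
    exact ⟨hc.momentL2 hu t, hc.symm.momentL2 hv t, hP, hQ⟩
  · rw [← e1] at hu
    exact hc.weightedL2 hs hu t
  · rw [← e2] at hv
    exact hc.symm.weightedL2 hs hv t
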